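/- **Theorem 3.5.** Let $M$ be a smooth $2n$-manifold and let $(\lambda,\alpha)$ be an exact lcs structure on $M$: $\lambda,\alpha$ are smooth 1-forms, $d\alpha=0$, and $\omega=d\lambda-\alpha\wedge\lambda$ is non-degenerate. Define vector fields $X_\lambda,X_\alpha$ by $\omega(X_\lambda,\cdot)=\lambda$, $\omega(X_\alpha,\cdot)=\alpha$, and put $\mathcal D(p)=\operatorname{span}(X_\alpha(p),X_\lambda(p))\subset T_pM$. A *closed nodal Riemann surface* $\Sigma$ is a closed (compact, without boundary, possibly disconnected) Riemann surface $\widetilde\Sigma$ together with finitely many pairwise disjoint pairs $\{z_i^0,z_i^1\}$ of distinct points of $\widetilde\Sigma$. We also write $\Sigma$ for the quotient space of $\widetilde\Sigma$ in which $z_i^0$ is identified with $z_i^1$ for each $i$; the images of the pairs are the *nodes*, and $q:\widetilde\Sigma\to\Sigma$ is the quotient map. A map $u:\Sigma\to M$ is called smooth, respectively an immersion, if its normalization $\widetilde u=u\circ q$ is. It is *normal* if $\Sigma$ has no nodes. $\Sigma$ is *elliptic* if it is connected and has (arithmetic) genus $1$, where the genus of a connected nodal surface whose normalization has components of genera $g_1,\dots,g_c$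 and which has $k$ nodes is $\sum_i g_i+k-c+1$, i.e. the genus of the surface obtained by smoothing the nodes. A *Reeb 2-curve* in $(M,\lambda,\alpha)$ is a smooth map $u:\Sigma\to M$ from a closed nodal Riemann surface such that 1. for every $z\in\widetilde\Sigma$ with $d\widetilde u(z)\neq0$ and $\dim\mathcal D(\widetilde u(z))=2$ one has $d\widetilde u(z)(T_z\widetilde\Sigma)=\mathcal D(\widetilde u(z))$; 2. $0\neq[u^*\alpha]\in H^1(\Sigma;\mathbb R)$, the pull-back by the continuous map $u$ of the class of $\alpha$ in $H^1(M;\mathbb R)$. A *Reeb 1-curve* is a smooth map $o:S^1=\mathbb R/\mathbb Z\to M$ with $\lambda(o'(t))>0$ and $o'(t)\in\mathcal D(o(t))$ for all $t$. Suppose that $(M,\lambda,\alpha)$ satisfies the Reeb condition: $\lambda(X_\alpha)>0$ everywhere on $M$. If there is an immersed Reeb 2-curve in $(M,\lambda,\alpha)$, then there is also a Reeb 1-curve in $(M,\lambda,\alpha)$. Moreover, every immersed Reeb 2-curve $u:\Sigma\to M$ with $\Sigma$ elliptic is normal. -/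

import Mathlib

open scoped Manifold ContDiff Topology

namespace Lcs

noncomputable section

/-! ### Differential forms of low degree on a smooth manifold -/

section Forms

/-- Smooth differential 1-forms on `M`, i.e. smooth sections of the cotangent bundle. -/
abbrev OneForm (m : ℕ) (M : Type*) [TopologicalSpace M]
    [ChartedSpace (EuclideanSpace ℝ (Fin m)) M] [IsManifold (𝓡 m) ∞ M] :=
  Cₛ^∞⟮𝓡 m; (EuclideanSpace ℝ (Fin m) →L[ℝ] ℝ),
    (fun p : M => TangentSpace (𝓡 m) p →L[ℝ] Bundle.Trivial M ℝ p)⟯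

variable {m : ℕ} {M : Type*} [TopologicalSpace M]
  [ChartedSpace (EuclideanSpace ℝ (Fin m)) M] [IsManifold (𝓡 m) ∞ M]

/-- The 1-form `(φ⁻¹)^* θ` on (the target of the chart in) `ℝ^m`, where `φ` is the preferred chart
at `p`. The trivialization of the tangent bundle at `p` is the one induced by `φ`, so its inverse
over the point `φ⁻¹ y` is the differential of `φ⁻¹` at `y`. -/
def chartRep (θ : ∀ q : M, TangentSpace (𝓡 m) q →L[ℝ] ℝ) (p : M) :
    EuclideanSpace ℝ (Fin m) → EuclideanSpace ℝ (Fin m) →L[ℝ] ℝ :=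
  fun y => (θ ((extChartAt (𝓡 m) p).symm y)).comp
    ((trivializationAt (EuclideanSpace ℝ (Fin m)) (TangentSpace (𝓡 m)) p).symmL ℝ
      ((extChartAt (𝓡 m) p).symm y))

/-- The differential at `p` of the preferred chart at `p`. -/
def chartDiff (p : M) : TangentSpace (𝓡 m) p →L[ℝ] EuclideanSpace ℝ (Fin m) :=
  (trivializationAt (EuclideanSpace ℝ (Fin m)) (TangentSpace (𝓡 m)) p).continuousLinearMapAt ℝ p

/-- The exterior derivative of a 1-form at the point `p`: with `φ` the preferred chart at `p` and
`η = (φ⁻¹)^* θ`, it is `φ^* dη` at `p`, where on `ℝ^m`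
`dη_y (a, b) = (D η_y a) b - (D η_y b) a`. -/
def extDerivOneForm (θ : ∀ q : M, TangentSpace (𝓡 m) q →L[ℝ] ℝ) (p : M) :
    LinearMap.BilinForm ℝ (TangentSpace (𝓡 m) p) :=
  LinearMap.mk₂ ℝ
    (fun v w =>
      fderiv ℝ (chartRep θ p) (extChartAt (𝓡 m) p p) (chartDiff p v) (chartDiff p w) -
      fderiv ℝ (chartRep θ p) (extChartAt (𝓡 m) p p) (chartDiff p w) (chartDiff p v))
    (by intros; simp only [map_add, add_apply]; ring)
    (by intros; simp only [map_smul, smul_apply, smul_eq_mul]; ring)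
    (by intros; simp only [map_add, add_apply]; ring)
    (by intros; simp only [map_smul, smul_apply, smul_eq_mul]; ring)

/-- The wedge product of two 1-forms at a point, `(θ ∧ η)(v, w) = θ v * η w - θ w * η v`. -/
def wedge {p : M} (θ η : TangentSpace (𝓡 m) p →L[ℝ] ℝ) :
    LinearMap.BilinForm ℝ (TangentSpace (𝓡 m) p) :=
  LinearMap.mk₂ ℝ (fun v w => θ v * η w - θ w * η v)
    (by intros; simp only [map_add]; ring)
    (by intros; simp only [map_smul, smul_eq_mul]; ring)
    (by intros; simp only [map_add]; ring)
    (by intros; simp only [map_smul, smul_eq_mul]; ring)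

end Forms

/-! ### Exact lcs manifolds -/

/-- An exact locally conformally symplectic structure `(λ, α)` on a smooth `2n`-manifold: `α` is
closed and `ω = dλ - α ∧ λ` is non-degenerate. -/
structure ExactLcs (n : ℕ) (M : Type*) [TopologicalSpace M]
    [ChartedSpace (EuclideanSpace ℝ (Fin (2 * n))) M] [IsManifold (𝓡 (2 * n)) ∞ M] where
  /-- the form `λ` -/
  lam : OneForm (2 * n) M
  /-- the Lee form `α` -/
  alpha : OneForm (2 * n) M
  closed : ∀ p : M, extDerivOneForm (⇑alpha) p = 0
  nondegenerate : ∀ (p : M) (v : TangentSpace (𝓡 (2 * n)) p),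
    (∀ w, (extDerivOneForm (⇑lam) p - wedge (alpha p) (lam p)) v w = 0) → v = 0

namespace ExactLcs

variable {n : ℕ} {M : Type*} [TopologicalSpace M]
  [ChartedSpace (EuclideanSpace ℝ (Fin (2 * n))) M] [IsManifold (𝓡 (2 * n)) ∞ M]

/-- The 2-form `ω = d_α λ = dλ - α ∧ λ`. -/
def omega (L : ExactLcs n M) (p : M) : LinearMap.BilinForm ℝ (TangentSpace (𝓡 (2 * n)) p) :=
  extDerivOneForm (⇑L.lam) p - wedge (L.alpha p) (L.lam p)

theorem existsUnique_dual (L : ExactLcs n M) (p : M) (θ : TangentSpace (𝓡 (2 * n)) p →L[ℝ] ℝ) :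
    ∃! X : TangentSpace (𝓡 (2 * n)) p, ∀ w, L.omega p X w = θ w := by
  have : FiniteDimensional ℝ (TangentSpace (𝓡 (2 * n)) p) :=
    inferInstanceAs (FiniteDimensional ℝ (EuclideanSpace ℝ (Fin (2 * n))))
  have hinj : Function.Injective (L.omega p) := by
    rw [injective_iff_map_eq_zero]
    intro v hv
    exact L.nondegenerate p v fun w => by
      have := congrArg (fun f => f w) hv
      exact this
  have hsurj : Function.Surjective (L.omega p) :=
    (LinearMap.injective_iff_surjective_of_finrank_eq_finrank
      (Subspace.dual_finrank_eq (K := ℝ) (V := TangentSpace (𝓡 (2 * n)) p)).symm).1 hinj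
  obtain ⟨X, hX⟩ := hsurj θ.toLinearMap
  refine ⟨X, fun w => by rw [hX]; rfl, fun Y hY => hinj ?_⟩
  rw [hX]
  ext w
  exact hY w

/-- The vector `X` at `p` with `ω (X, ·) = θ`. -/
def dual (L : ExactLcs n M) (p : M) (θ : TangentSpace (𝓡 (2 * n)) p →L[ℝ] ℝ) :
    TangentSpace (𝓡 (2 * n)) p :=
  (L.existsUnique_dual p θ).choose

theorem omega_dual (L : ExactLcs n M) (p : M) (θ : TangentSpace (𝓡 (2 * n)) p →L[ℝ] ℝ)
    (w : TangentSpace (𝓡 (2 * n)) p) : L.omega p (L.dual p θ) w = θ w :=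
  (L.existsUnique_dual p θ).choose_spec.1 w

/-- The vector field `X_λ`, with `ω (X_λ, ·) = λ`. -/
def XLam (L : ExactLcs n M) (p : M) : TangentSpace (𝓡 (2 * n)) p := L.dual p (L.lam p)

/-- The vector field `X_α`, with `ω (X_α, ·) = α`. -/
def XAlpha (L : ExactLcs n M) (p : M) : TangentSpace (𝓡 (2 * n)) p := L.dual p (L.alpha p)

/-- The canonical (generalized) distribution `𝓓 = span (X_α, X_λ)`. -/
def canonicalDistribution (L : ExactLcs n M) (p : M) :
    Submodule ℝ (TangentSpace (𝓡 (2 * n)) p) :=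
  Submodule.span ℝ {L.XAlpha p, L.XLam p}

/-- The Reeb condition `λ (X_α) > 0`. -/
def ReebCondition (L : ExactLcs n M) : Prop :=
  ∀ p : M, 0 < L.lam p (L.XAlpha p)

/-- A Reeb 1-curve: a smooth map `o : S¹ = ℝ/ℤ → M` whose velocity `o'(t)` lies in `𝓓` and
satisfies `λ (o'(t)) > 0` for all `t`. -/
def IsReebOneCurve (L : ExactLcs n M) (o : UnitAddCircle → M) : Prop :=
  ContMDiff 𝓘(ℝ, ℝ) (𝓡 (2 * n)) ∞ (fun t : ℝ => o t) ∧
  ∀ t : ℝ,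
    0 < L.lam (o t) (mfderiv 𝓘(ℝ, ℝ) (𝓡 (2 * n)) (fun s : ℝ => o s) t (1 : ℝ)) ∧
    mfderiv 𝓘(ℝ, ℝ) (𝓡 (2 * n)) (fun s : ℝ => o s) t (1 : ℝ) ∈ L.canonicalDistribution (o t)

end ExactLcs

/-! ### Singular cohomology in degree one and the class of a pulled back closed 1-form -/

/-- The coboundary from singular 0-cochains to singular 1-cochains of `X` with real coefficients
(singular 1-simplices are paths `[0,1] → X`). The first singular cohomology `H¹(X; ℝ)` consists of
the singular 1-cocycles modulo the range of this map. -/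
def singularCoboundary (X : Type*) [TopologicalSpace X] :
    (X → ℝ) →ₗ[ℝ] (C(unitInterval, X) → ℝ) where
  toFun f := fun γ => f (γ 1) - f (γ 0)
  map_add' f g := by ext γ; simp only [Pi.add_apply]; ring
  map_smul' c f := by ext γ; simp only [Pi.smul_apply, smul_eq_mul, RingHom.id_apply]; ring

section PullbackClass

variable {m : ℕ} {M : Type*} [TopologicalSpace M]
  [ChartedSpace (EuclideanSpace ℝ (Fin m)) M]

/-- `F` is a primitive of the closed 1-form `θ` along the path `γ`: near each parameter, `F`
differs by a constant from `g ∘ γ` for some smooth local primitive `g` of `θ`. -/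
def IsPrimitiveAlong (θ : ∀ q : M, TangentSpace (𝓡 m) q →L[ℝ] ℝ)
    (γ : unitInterval → M) (F : unitInterval → ℝ) : Prop :=
  ∀ t : unitInterval, ∃ (U : Set M) (g : M → ℝ), IsOpen U ∧ γ t ∈ U ∧
    ContMDiffOn (𝓡 m) 𝓘(ℝ, ℝ) ∞ g U ∧
    (∀ q ∈ U, ∀ v : TangentSpace (𝓡 m) q, mfderiv (𝓡 m) 𝓘(ℝ, ℝ) g q v = θ q v) ∧
    ∀ᶠ s in 𝓝 t, F s - F t = g (γ s) - g (γ t)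

open Classical in
/-- The integral `∫_γ θ` of a closed 1-form along a continuous path. (A primitive along a
continuous path always exists when `θ` is closed and is unique up to a constant.) -/
def closedFormIntegral (θ : ∀ q : M, TangentSpace (𝓡 m) q →L[ℝ] ℝ) (γ : unitInterval → M) : ℝ :=
  if h : ∃ F : unitInterval → ℝ, IsPrimitiveAlong θ γ F then h.choose 1 - h.choose 0 else 0

/-- The singular 1-cocycle `γ ↦ ∫_{u ∘ γ} θ` on `X`, which represents the pull-back by the
continuous map `u : X → M` of the de Rham class of the closed 1-form `θ`. -/
def pullbackCocycle {X : Type*} [TopologicalSpace X]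
    (θ : ∀ q : M, TangentSpace (𝓡 m) q →L[ℝ] ℝ) (u : X → M) : C(unitInterval, X) → ℝ :=
  fun γ => closedFormIntegral θ (fun t => u (γ t))

end PullbackClass

/-! ### Closed nodal Riemann surfaces -/

/-- A finite collection of disjoint pairs of distinct points of `S`, the `i`-th pair being
`point (i, false)`, `point (i, true)`. For `S` a closed Riemann surface this is a closed nodal
Riemann surface `Σ` with normalization `S`. -/
structure NodalStructure (S : Type*) where
  /-- the number of nodes -/
  nodes : ℕ
  /-- the two preimages of each node -/
  point : Fin nodes × Bool → S
  injective : Function.Injective point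

namespace NodalStructure

variable {S : Type*}

/-- The space obtained from `S` by gluing the two points of each pair, with the quotient topology
when `S` is a topological space. -/
abbrev Space (N : NodalStructure S) : Type _ :=
  Quot (fun x y : S => ∃ i : Fin N.nodes, x = N.point (i, false) ∧ y = N.point (i, true))

/-- The quotient map from the normalization. -/
def proj (N : NodalStructure S) : S → N.Space := Quot.mk _

/-- A nodal Riemann surface is normal if it has no nodes. -/
def IsNormal (N : NodalStructure S) : Prop := N.nodes = 0

end NodalStructure

/-- The boundary points `exp (2 π i τ / 4g)` of the unit disk, seen as a polygon with `4 g` sides,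
the `k`-th side being `τ ∈ [k, k + 1]`. -/
def polygonPoint (g : ℕ) (τ : ℝ) : ℂ :=
  Complex.exp (2 * Real.pi * Complex.I * (τ / (4 * g)))

/-- The gluing of the sides of the `4 g`-gon according to the word
`∏ⱼ aⱼ bⱼ aⱼ⁻¹ bⱼ⁻¹`: for `s = 0` this glues the sides `aⱼ` and `aⱼ⁻¹`, for `s = 1` the sides
`bⱼ` and `bⱼ⁻¹`. -/
def polygonRel (g : ℕ) (x y : Metric.closedBall (0 : ℂ) 1) : Prop :=
  ∃ (j : Fin g) (s : Fin 2) (t : unitInterval),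
    (x : ℂ) = polygonPoint g (4 * (j : ℕ) + (s : ℕ) + t) ∧
    (y : ℂ) = polygonPoint g (4 * (j : ℕ) + (s : ℕ) + 3 - t)

/-- A topological space is a closed connected orientable surface of genus `g`: it is homeomorphic
to the sphere `S²` if `g = 0`, and to the standard quotient of the `4 g`-gon if `g ≥ 1`. -/
def IsSurfaceOfGenus (g : ℕ) (X : Type*) [TopologicalSpace X] : Prop :=
  (g = 0 ∧ Nonempty (X ≃ₜ Metric.sphere (0 : EuclideanSpace ℝ (Fin 3)) 1)) ∨
  (1 ≤ g ∧ Nonempty (X ≃ₜ Quot (polygonRel g)))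

namespace NodalStructure

variable {S : Type*} [TopologicalSpace S]

/-- The nodal surface has topological (arithmetic) genus `p`: its normalization has finitely many
components, `c` in number, of genera `g₁, …, g_c`, and `p = ∑ gᵢ + (number of nodes) - c + 1`.
For connected nodal surfaces this is the genus of the closed surface obtained by replacing a
neighbourhood of each node by a cylinder. -/
def HasGenus (N : NodalStructure S) (p : ℕ) : Prop :=
  ∃ (c : ℕ) (e : Fin c ≃ ConnectedComponents S) (g : Fin c → ℕ),
    (∀ i, IsSurfaceOfGenus (g i) {x : S // ConnectedComponents.mk x = e i}) ∧
    ∑ i, g i + N.nodes + 1 = p + c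

/-- A closed nodal Riemann surface is elliptic if it is connected and of genus 1. -/
def IsElliptic (N : NodalStructure S) : Prop := ConnectedSpace N.Space ∧ N.HasGenus 1

end NodalStructure

/-! ### Reeb 2-curves -/

/-- A map `u : Σ → M` from a nodal Riemann surface to an `m`-manifold is an immersion if its
normalization `ũ = u ∘ q` is a smooth immersion. -/
def IsImmersedCurve (m : ℕ) {M : Type*} [TopologicalSpace M]
    [ChartedSpace (EuclideanSpace ℝ (Fin m)) M] {S : Type*} [TopologicalSpace S]
    [ChartedSpace ℂ S] (N : NodalStructure S) (u : N.Space → M) : Prop :=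
  ContMDiff 𝓘(ℝ, ℂ) (𝓡 m) ∞ (u ∘ N.proj) ∧
  ∀ z : S, Function.Injective (mfderiv 𝓘(ℝ, ℂ) (𝓡 m) (u ∘ N.proj) z)

section Reeb2

variable {n : ℕ} {M : Type*} [TopologicalSpace M]
  [ChartedSpace (EuclideanSpace ℝ (Fin (2 * n))) M] [IsManifold (𝓡 (2 * n)) ∞ M]
  {S : Type*} [TopologicalSpace S] [ChartedSpace ℂ S]

/-- A Reeb 2-curve in `(M, λ, α)`: a smooth map `u` from the closed nodal Riemann surface `Σ` to
`M` (i.e. its normalization `ũ = u ∘ q` is smooth) such that the image of `dũ` at `z` is `𝓓` at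
every point where `dũ ≠ 0` and `dim 𝓓 = 2`, and such that `[u^* α] ≠ 0` in `H¹(Σ; ℝ)`, i.e. the
cocycle representing this class is not a coboundary. -/
structure IsReebTwoCurve (L : ExactLcs n M) (N : NodalStructure S) (u : N.Space → M) : Prop where
  smooth : ContMDiff 𝓘(ℝ, ℂ) (𝓡 (2 * n)) ∞ (u ∘ N.proj)
  tangent : ∀ z : S,
    mfderiv 𝓘(ℝ, ℂ) (𝓡 (2 * n)) (u ∘ N.proj) z ≠ 0 →
    Module.finrank ℝ (L.canonicalDistribution ((u ∘ N.proj) z)) = 2 →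
    (mfderiv 𝓘(ℝ, ℂ) (𝓡 (2 * n)) (u ∘ N.proj) z).range =
      L.canonicalDistribution ((u ∘ N.proj) z)
  class_ne_zero : pullbackCocycle (⇑L.alpha) u ∉ (singularCoboundary N.Space).range

end Reeb2

end

end Lcs

/-! ### Reeb curves under the Reeb condition -/

namespace Lcs

/-! ### Local primitives of a closed 1-form. -/

section Poincare

variable {m : ℕ} {M : Type*} [TopologicalSpace M]
  [ChartedSpace (EuclideanSpace ℝ (Fin m)) M] [IsManifold (𝓡 m) ∞ M]

/-! Under the Reeb condition the pairings λ(X_α) and α(X_λ) = -λ(X_α) are nowhere zero, while λ(X_λ)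
and α(X_α) vanish. So 𝓓 has rank 2 everywhere, and an immersed Reeb 2-curve is tangent to it at
every point. Hence both ũ*λ and ũ*α are nowhere zero on the compact surface `S`, which is nonempty
because the class of u*α is nonzero.

Existence of a Reeb 1-curve: any nowhere zero continuous 1-form β on a nonempty compact manifold
admits a smooth closed curve on which it is positive (`exists_periodic_positive`). The relation
"some β-positive curve runs from x to y" is transitive, because corners can be rounded, and every
point has a neighbourhood reachable from one common point. By compactness finitely many starting
points suffice, and each is reachable from one of them. A finite transitive relation without a
minimal element is not irreflexive, so some point reaches itself, and closing up that curve smoothly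
gives the loop. Its image under ũ, for β = ũ*λ, is a Reeb 1-curve.

Normality: no component of `S` is a sphere (`IsReebTwoCurve.not_homeomorph_sphere`). On a sphere the
closed form ũ*α would have a global primitive, whose maximum would be a zero of ũ*α. With all g_i ≥
1, the equation ∑ g_i + k - c + 1 = 1 leaves no room for nodes. -/

theorem chartRep_eq_comp_mfderiv (θ : ∀ q : M, TangentSpace (𝓡 m) q →L[ℝ] ℝ) (p : M)
    {y : EuclideanSpace ℝ (Fin m)} (hy : y ∈ (extChartAt (𝓡 m) p).target) :
    chartRep θ p y = (θ ((extChartAt (𝓡 m) p).symm y)).comp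
      (mfderiv 𝓘(ℝ, EuclideanSpace ℝ (Fin m)) (𝓡 m) (extChartAt (𝓡 m) p).symm y) := by
  have hs : (extChartAt (𝓡 m) p).symm y ∈ (chartAt (EuclideanSpace ℝ (Fin m)) p).source := by
    rw [← extChartAt_source (𝓡 m)]; exact (extChartAt (𝓡 m) p).map_target hy
  have : IsManifold (𝓡 m) 1 M := .of_le (n := ∞) (by simp)
  unfold chartRep
  rw [TangentBundle.symmL_trivializationAt hs, (extChartAt (𝓡 m) p).right_inv hy,
    ModelWithCorners.range_eq_univ, mfderivWithin_univ]
  rfl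

theorem contDiffOn_chartRep (θ : OneForm m M) (p : M) :
    ContDiffOn ℝ ∞ (chartRep (⇑θ) p) (extChartAt (𝓡 m) p).target := by
  rw [← contMDiffOn_iff_contDiffOn]
  have h1 := ((trivializationAt (EuclideanSpace ℝ (Fin m) →L[ℝ] ℝ)
    (fun p : M => TangentSpace (𝓡 m) p →L[ℝ] Bundle.Trivial M ℝ p)
    p).contMDiffOn_section_baseSet_iff (IB := 𝓡 m) (n := ∞) (s := ⇑θ)).1 θ.contMDiff.contMDiffOn
  have h2 := h1.comp (contMDiffOn_extChartAt_symm (I := 𝓡 m) (n := ∞) p) (fun y hy => by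
    have := (extChartAt (𝓡 m) p).map_target hy
    rw [extChartAt_source] at this
    simpa using this)
  refine h2.congr fun y hy => ?_
  simp only [Function.comp_apply, hom_trivializationAt_apply, ContinuousLinearMap.inCoordinates]
  unfold chartRep
  have h3 := Bundle.Trivial.continuousLinearMapAt_trivialization ℝ M ℝ
    ((extChartAt (𝓡 m) p).symm y)
  ext v
  exact (DFunLike.congr_fun h3 _).symm

/-- Closedness is stated at each point in that point's own preferred chart, whereas the Poincaré
lemma needs it throughout a single chart. This change-of-chart law moves between the two. -/
theorem chartRep_eventuallyEq (θ : ∀ q : M, TangentSpace (𝓡 m) q →L[ℝ] ℝ) (p q : M)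
    {y : EuclideanSpace ℝ (Fin m)} (hy : y ∈ (extChartAt (𝓡 m) p).target)
    (hq : (extChartAt (𝓡 m) p).symm y ∈ (extChartAt (𝓡 m) q).source) :
    chartRep θ p =ᶠ[𝓝 y] fun x =>
      (chartRep θ q ((extChartAt (𝓡 m) q ∘ (extChartAt (𝓡 m) p).symm) x)).comp
        (fderiv ℝ (extChartAt (𝓡 m) q ∘ (extChartAt (𝓡 m) p).symm) x) := by
  have hopen := (continuousOn_extChartAt_symm p).isOpen_inter_preimage
    (isOpen_extChartAt_target (I := 𝓡 m) p) (isOpen_extChartAt_source (I := 𝓡 m) q)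
  filter_upwards [hopen.mem_nhds ⟨hy, hq⟩] with x hx
  obtain ⟨hx1, hx2⟩ := hx
  have hx3 := (extChartAt (𝓡 m) q).map_source hx2
  have hleft := (extChartAt (𝓡 m) q).left_inv hx2
  rw [chartRep_eq_comp_mfderiv θ p hx1, Function.comp_apply, chartRep_eq_comp_mfderiv θ q hx3]
  have hev : (extChartAt (𝓡 m) p).symm =ᶠ[𝓝 x]
      (extChartAt (𝓡 m) q).symm ∘ (extChartAt (𝓡 m) q ∘ (extChartAt (𝓡 m) p).symm) := by
    filter_upwards [hopen.mem_nhds ⟨hx1, hx2⟩] with z hz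
    exact ((extChartAt (𝓡 m) q).left_inv hz.2).symm
  have hp : MDifferentiableAt 𝓘(ℝ, EuclideanSpace ℝ (Fin m)) (𝓡 m) (extChartAt (𝓡 m) p).symm x :=
    ((contMDiffOn_extChartAt_symm (n := ∞) p).contMDiffAt
      ((isOpen_extChartAt_target p).mem_nhds hx1)).mdifferentiableAt (by simp)
  have hqs : MDifferentiableAt 𝓘(ℝ, EuclideanSpace ℝ (Fin m)) (𝓡 m) (extChartAt (𝓡 m) q).symm
      (extChartAt (𝓡 m) q ((extChartAt (𝓡 m) p).symm x)) :=
    ((contMDiffOn_extChartAt_symm (n := ∞) q).contMDiffAt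
      ((isOpen_extChartAt_target q).mem_nhds hx3)).mdifferentiableAt (by simp)
  have hqq : MDifferentiableAt (𝓡 m) 𝓘(ℝ, EuclideanSpace ℝ (Fin m)) (extChartAt (𝓡 m) q)
      ((extChartAt (𝓡 m) p).symm x) :=
    (contMDiffAt_extChartAt' (n := ∞) (by rwa [extChartAt_source] at hx2)).mdifferentiableAt
      (by simp)
  rw [hev.mfderiv_eq, mfderiv_comp x (by exact hqs) (hqq.comp x hp), mfderiv_eq_fderiv]
  simp only [Function.comp_apply]
  rw [hleft]
  rfl

theorem contDiffAt_chart_transition (p q : M)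
    {y : EuclideanSpace ℝ (Fin m)} (hy : y ∈ (extChartAt (𝓡 m) p).target)
    (hq : (extChartAt (𝓡 m) p).symm y ∈ (extChartAt (𝓡 m) q).source) :
    ContDiffAt ℝ ∞ (extChartAt (𝓡 m) q ∘ (extChartAt (𝓡 m) p).symm) y := by
  rw [← contMDiffAt_iff_contDiffAt]
  exact (contMDiffAt_extChartAt' (by rwa [extChartAt_source] at hq)).comp y
    ((contMDiffOn_extChartAt_symm p).contMDiffAt ((isOpen_extChartAt_target p).mem_nhds hy))

/-- Pull-back preserves closedness: differentiating τ*A produces A'(τ'a)(τ'b) plus A applied to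
τ''(a, b), and the second term is symmetric because second derivatives are. -/
theorem fderiv_clm_comp_fderiv_symm {E : Type*} [NormedAddCommGroup E] [NormedSpace ℝ E]
    {A : E → E →L[ℝ] ℝ} {τ : E → E} {y : E} (hτ : ContDiffAt ℝ 2 τ y)
    (hA : DifferentiableAt ℝ A (τ y))
    (hsymm : ∀ a b, fderiv ℝ A (τ y) a b = fderiv ℝ A (τ y) b a) (a b : E) :
    fderiv ℝ (fun x => (A (τ x)).comp (fderiv ℝ τ x)) y a b =
      fderiv ℝ (fun x => (A (τ x)).comp (fderiv ℝ τ x)) y b a := by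
  have h1 : DifferentiableAt ℝ (fderiv ℝ τ) y :=
    (hτ.fderiv_right (m := 1) (by norm_num)).differentiableAt (by norm_num)
  have h2 : HasFDerivAt (fun x => A (τ x)) ((fderiv ℝ A (τ y)).comp (fderiv ℝ τ y)) y :=
    hA.hasFDerivAt.comp y (hτ.differentiableAt (by norm_num)).hasFDerivAt
  have h3 : IsSymmSndFDerivAt ℝ τ y := hτ.isSymmSndFDerivAt (by simp)
  rw [(h2.clm_comp h1.hasFDerivAt).fderiv]
  simp [h3 a b, hsymm (fderiv ℝ τ y a)]

theorem fderiv_chartRep_symm (θ : OneForm m M) (hθ : ∀ p, extDerivOneForm (⇑θ) p = 0) (p : M)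
    {y : EuclideanSpace ℝ (Fin m)} (hy : y ∈ (extChartAt (𝓡 m) p).target)
    (a b : EuclideanSpace ℝ (Fin m)) :
    fderiv ℝ (chartRep (⇑θ) p) y a b = fderiv ℝ (chartRep (⇑θ) p) y b a := by
  set q := (extChartAt (𝓡 m) p).symm y with hqdef
  have hq := mem_extChartAt_source (I := 𝓡 m) q
  rw [(chartRep_eventuallyEq (⇑θ) p q hy hq).fderiv_eq]
  have hτy : (extChartAt (𝓡 m) q ∘ (extChartAt (𝓡 m) p).symm) y = extChartAt (𝓡 m) q q := rfl
  apply fderiv_clm_comp_fderiv_symm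
  · exact (contDiffAt_chart_transition p q hy hq).of_le (WithTop.coe_le_coe.2 (le_top : (2 : ℕ∞) ≤ ⊤))
  · rw [hτy]
    exact ((contDiffOn_chartRep θ q).contDiffAt
      (extChartAt_target_mem_nhds q)).differentiableAt (by simp)
  · rw [hτy]
    intro a b
    have hb : q ∈ (trivializationAt (EuclideanSpace ℝ (Fin m)) (TangentSpace (𝓡 m)) q).baseSet :=
      FiberBundle.mem_baseSet_trivializationAt' q
    have h := congrArg (fun B : LinearMap.BilinForm ℝ (TangentSpace (𝓡 m) q) => B
      ((trivializationAt (EuclideanSpace ℝ (Fin m)) (TangentSpace (𝓡 m)) q).symmL ℝ q a)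
      ((trivializationAt (EuclideanSpace ℝ (Fin m)) (TangentSpace (𝓡 m)) q).symmL ℝ q b)) (hθ q)
    simp only [extDerivOneForm, LinearMap.mk₂_apply, chartDiff,
      Bundle.Trivialization.continuousLinearMapAt_symmL _ hb, LinearMap.zero_apply] at h
    linarith

/-- A closed 1-form has local primitives. -/
theorem exists_local_primitive (θ : OneForm m M)
    (hθ : ∀ p, extDerivOneForm (⇑θ) p = 0) (p : M) :
    ∃ (U : Set M) (g : M → ℝ), IsOpen U ∧ p ∈ U ∧
      ∀ q ∈ U, HasMFDerivAt (𝓡 m) 𝓘(ℝ, ℝ) g q (θ q) := by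
  obtain ⟨r, hr, hball⟩ := Metric.isOpen_iff.1 (isOpen_extChartAt_target (I := 𝓡 m) p) _
    (mem_extChartAt_target p)
  obtain ⟨f, hf⟩ := (convex_ball _ r).exists_forall_hasFDerivAt_of_fderiv_symmetric
    Metric.isOpen_ball (((contDiffOn_chartRep θ p).differentiableOn (by simp)).mono hball)
    (fun a ha => fderiv_chartRep_symm θ hθ p (hball ha))
  refine ⟨(extChartAt (𝓡 m) p).source ∩ extChartAt (𝓡 m) p ⁻¹' Metric.ball _ r,
    f ∘ extChartAt (𝓡 m) p, (continuousOn_extChartAt p).isOpen_inter_preimage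
      (isOpen_extChartAt_source p) Metric.isOpen_ball,
    ⟨mem_extChartAt_source p, Metric.mem_ball_self hr⟩, fun q ⟨hq1, hq2⟩ => ?_⟩
  have hq1' : q ∈ (chartAt (EuclideanSpace ℝ (Fin m)) p).source := by
    rwa [extChartAt_source] at hq1
  have hc : MDifferentiableAt (𝓡 m) 𝓘(ℝ, EuclideanSpace ℝ (Fin m)) (extChartAt (𝓡 m) p) q :=
    (contMDiffAt_extChartAt' (n := ∞) hq1').mdifferentiableAt (by simp)
  have hy := (extChartAt (𝓡 m) p).map_source hq1
  have hleft := (extChartAt (𝓡 m) p).left_inv hq1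
  have h1 : HasMFDerivAt (𝓡 m) 𝓘(ℝ, ℝ) (f ∘ extChartAt (𝓡 m) p) q
      ((chartRep (⇑θ) p (extChartAt (𝓡 m) p q)).comp
        (mfderiv (𝓡 m) 𝓘(ℝ, EuclideanSpace ℝ (Fin m)) (extChartAt (𝓡 m) p) q)) :=
    (hf _ hq2).hasMFDerivAt.comp q hc.hasMFDerivAt
  have : IsManifold (𝓡 m) 1 M := .of_le (n := ∞) (by simp)
  have h2 : (chartRep (⇑θ) p (extChartAt (𝓡 m) p q)).comp
      (mfderiv (𝓡 m) 𝓘(ℝ, EuclideanSpace ℝ (Fin m)) (extChartAt (𝓡 m) p) q) = θ q := by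
    unfold chartRep
    rw [hleft, ← TangentBundle.continuousLinearMapAt_trivializationAt hq1']
    ext v
    simp only [ContinuousLinearMap.comp_apply]
    rw [Bundle.Trivialization.symmL_continuousLinearMapAt]
    simpa using hq1'
  rwa [h2] at h1

end Poincare

/-! ### Rounding a corner in a normed space. -/

section SmoothCorner

open Filter Set

/-- Interpolating two lines of slopes a₁ and a₂ by χ gives slope a₁ + (χ + sχ')(a₂ - a₁). The sign
of sχ' is controlled by letting χ rise on [0, 1] if a₁ ≤ a₂, and on [-1, 0] otherwise. Then the
slope never falls below min(a₁, a₂). -/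
theorem exists_corner_cutoff {a₁ a₂ : ℝ} (h₁ : 0 < a₁) (h₂ : 0 < a₂) :
    ∃ χ : ℝ → ℝ, ContDiff ℝ ∞ χ ∧ (∀ s ≤ -1, χ s = 0) ∧ (∀ s, 1 ≤ s → χ s = 1) ∧
      ∀ s, 0 < a₁ + (χ s + s * deriv χ s) * (a₂ - a₁) := by
  have hmono : ∀ x, 0 ≤ deriv Real.smoothTransition x :=
    fun x => Real.smoothTransition.monotone.deriv_nonneg
  have hd : ∀ x ≤ 0, deriv Real.smoothTransition x = 0 := fun x hx =>
    IsLocalMin.deriv_eq_zero (Eventually.of_forall fun y => by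
      rw [Real.smoothTransition.zero_of_nonpos hx]; exact Real.smoothTransition.nonneg y)
  have hd1 : ∀ x, 1 ≤ x → deriv Real.smoothTransition x = 0 := fun x hx =>
    IsLocalMax.deriv_eq_zero (Eventually.of_forall fun y => by
      rw [Real.smoothTransition.one_of_one_le hx]; exact Real.smoothTransition.le_one y)
  rcases le_total a₁ a₂ with h | h
  · refine ⟨Real.smoothTransition, Real.smoothTransition.contDiff,
      fun s hs => Real.smoothTransition.zero_of_nonpos (by linarith),
      fun s hs => Real.smoothTransition.one_of_one_le hs, fun s => ?_⟩
    have h3 : 0 ≤ s * deriv Real.smoothTransition s := by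
      rcases le_total s 0 with hs | hs
      · simp [hd s hs]
      · exact mul_nonneg hs (hmono s)
    have := mul_nonneg (add_nonneg (Real.smoothTransition.nonneg s) h3) (sub_nonneg.2 h)
    linarith
  · refine ⟨fun s => Real.smoothTransition (s + 1),
      Real.smoothTransition.contDiff.comp (contDiff_id.add contDiff_const),
      fun s hs => Real.smoothTransition.zero_of_nonpos (by linarith),
      fun s hs => Real.smoothTransition.one_of_one_le (by linarith), fun s => ?_⟩
    rw [deriv_comp_add_const]
    have h3 : s * deriv Real.smoothTransition (s + 1) ≤ 0 := by
      rcases le_total s 0 with hs | hs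
      · exact mul_nonpos_of_nonpos_of_nonneg hs (hmono _)
      · simp [hd1 (s + 1) (by linarith)]
    nlinarith [Real.smoothTransition.le_one (s + 1), Real.smoothTransition.nonneg (s + 1)]

variable {E : Type*} [NormedAddCommGroup E] [NormedSpace ℝ E]

/-- The curve is c₁ + χ(t/δ)(c₂ - c₁). The factor 1/δ from differentiating χ is harmless: c₂ - c₁
vanishes at 0, so it equals t·d(t) with d continuous at 0. With t = δs, as δ → 0 the velocity tends
to c₁'(0) + (χ + sχ')(c₂'(0) - c₁'(0)), on which `l` is positive by the choice of χ. Compactness of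
[-1, 1] makes one δ work for all s. -/
theorem exists_smooth_corner {c₁ c₂ : ℝ → E} (h₁ : ∀ᶠ t in 𝓝 0, ContDiffAt ℝ ∞ c₁ t)
    (h₂ : ∀ᶠ t in 𝓝 0, ContDiffAt ℝ ∞ c₂ t) (h₀ : c₁ 0 = c₂ 0) {P : Set (E × E)} (hP : IsOpen P)
    (l : E →ₗ[ℝ] ℝ) (hl : ∀ w, 0 < l w → (c₁ 0, w) ∈ P)
    (hl₁ : 0 < l (deriv c₁ 0)) (hl₂ : 0 < l (deriv c₂ 0)) {ε : ℝ} (hε : 0 < ε) :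
    ∃ δ, 0 < δ ∧ δ < ε ∧ ∃ c : ℝ → E, (∀ t ≤ -δ, c t = c₁ t) ∧ (∀ t, δ ≤ t → c t = c₂ t) ∧
      ∀ t ∈ Icc (-δ) δ, ContDiffAt ℝ ∞ c t ∧ (c t, deriv c t) ∈ P := by
  obtain ⟨χ, hχ, hχ0, hχ1, hχpos⟩ := exists_corner_cutoff hl₁ hl₂
  have hdiff₁ := h₁.self_of_nhds.differentiableAt (by simp)
  have hdiff₂ := h₂.self_of_nhds.differentiableAt (by simp)
  have hcd : ∀ {c : ℝ → E}, ContDiffAt ℝ ∞ c 0 → ContinuousAt (deriv c) 0 := fun {c} hc =>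
    ((hc.fderiv_right (m := 0) (by simp)).continuousAt.clm_apply
      (continuousAt_const (y := (1 : ℝ)))).congr (Eventually.of_forall fun x => by simp)
  have hd := hcd h₁.self_of_nhds
  have hd' := hcd h₂.self_of_nhds
  set d := dslope (fun t => c₂ t - c₁ t) 0 with hddef
  have hd0 : d 0 = deriv c₂ 0 - deriv c₁ 0 := by
    rw [hddef, dslope_same, deriv_fun_sub hdiff₂ hdiff₁]
  have hdcont : ContinuousAt d 0 := continuousAt_dslope_same.2 (hdiff₂.sub hdiff₁)
  have hdmul : ∀ t, t • d t = c₂ t - c₁ t := fun t => by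
    have := sub_smul_dslope (fun t => c₂ t - c₁ t) 0 t
    simpa [h₀] using this
  have hkey : ∀ᶠ δ in 𝓝 (0 : ℝ), ∀ s ∈ Icc (-1 : ℝ) 1,
      ContDiffAt ℝ ∞ c₁ (δ * s) ∧ ContDiffAt ℝ ∞ c₂ (δ * s) ∧
      (c₁ (δ * s) + χ s • (c₂ (δ * s) - c₁ (δ * s)),
        deriv c₁ (δ * s) + χ s • (deriv c₂ (δ * s) - deriv c₁ (δ * s)) +
          (deriv χ s * s) • d (δ * s)) ∈ P := by
    refine isCompact_Icc.eventually_forall_of_forall_eventually fun s hs => ?_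
    have hm : Tendsto (fun z : ℝ × ℝ => z.1 * z.2) (𝓝 (0, s)) (𝓝 0) := by
      have : ContinuousAt (fun z : ℝ × ℝ => z.1 * z.2) (0, s) := by fun_prop
      simpa [ContinuousAt] using this
    refine (hm.eventually h₁).and ((hm.eventually h₂).and ?_)
    have hχc : ContinuousAt (fun z : ℝ × ℝ => χ z.2) (0, s) :=
      (hχ.continuous.comp continuous_snd).continuousAt
    have hχd : ContinuousAt (fun z : ℝ × ℝ => deriv χ z.2) (0, s) :=
      ((hχ.continuous_deriv (by simp)).comp continuous_snd).continuousAt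
    have hcomp : ∀ {c : ℝ → E}, ContinuousAt c 0 →
        ContinuousAt (fun z : ℝ × ℝ => c (z.1 * z.2)) (0, s) := fun {c} hc => by
      refine ContinuousAt.comp (g := c) (f := fun z : ℝ × ℝ => z.1 * z.2) ?_ (by fun_prop)
      simpa using hc
    have hc1 := hcomp hdiff₁.continuousAt
    have hc2 := hcomp hdiff₂.continuousAt
    have hcont := (hc1.add (hχc.smul (hc2.sub hc1))).prodMk
      (((hcomp hd).add (hχc.smul ((hcomp hd').sub (hcomp hd)))).add
        ((hχd.mul continuousAt_snd).smul (hcomp hdcont)))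
    have hmem : (c₁ (0 * s) + χ s • (c₂ (0 * s) - c₁ (0 * s)),
        deriv c₁ (0 * s) + χ s • (deriv c₂ (0 * s) - deriv c₁ (0 * s)) +
          (deriv χ s * s) • d (0 * s)) ∈ P := by
      simp only [zero_mul, ← h₀, sub_self, smul_zero, add_zero, hd0]
      apply hl
      simp only [map_add, map_smul, map_sub, smul_eq_mul]
      linarith [hχpos s]
    exact hcont.eventually_mem (hP.mem_nhds hmem)
  obtain ⟨δ, ⟨hδ, hδε⟩, hδpos⟩ :=
    (((hkey.and (Iio_mem_nhds hε)).filter_mono nhdsWithin_le_nhds).and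
      (self_mem_nhdsWithin (s := Ioi (0 : ℝ)))).exists
  replace hδpos : 0 < δ := hδpos
  refine ⟨δ, hδpos, hδε, fun t => c₁ t + χ (t / δ) • (c₂ t - c₁ t), fun t ht => ?_,
    fun t ht => ?_, fun t ht => ?_⟩
  · have : t / δ ≤ -1 := by rw [div_le_iff₀ hδpos]; linarith
    simp [hχ0 _ this]
  · have : 1 ≤ t / δ := by rw [le_div_iff₀ hδpos]; linarith
    simp [hχ1 _ this]
  · obtain ⟨k1, k2, k3⟩ := hδ (t / δ) ⟨by rw [le_div_iff₀ hδpos]; linarith [ht.1],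
      by rw [div_le_iff₀ hδpos]; linarith [ht.2]⟩
    have ht' : δ * (t / δ) = t := by field_simp
    rw [ht'] at k1 k2 k3
    have hs : ContDiff ℝ ∞ (fun t => χ (t / δ)) := hχ.comp (contDiff_id.div_const δ)
    refine ⟨k1.add (hs.contDiffAt.smul (k2.sub k1)), ?_⟩
    convert k3 using 2
    have e1 := (k1.differentiableAt (by simp)).hasDerivAt
    have e2 := (k2.differentiableAt (by simp)).hasDerivAt
    have e3 : HasDerivAt (fun t => χ (t / δ)) (deriv χ (t / δ) * (1 / δ)) t :=
      HasDerivAt.comp (h₂ := χ) t ((hχ.differentiable (by simp)) (t / δ)).hasDerivAt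
        ((hasDerivAt_id t).div_const δ)
    refine (e1.add (e3.smul (e2.sub e1))).deriv.trans ?_
    rw [Pi.sub_apply, ← hdmul, smul_smul, ← add_assoc]
    congr 2
    field_simp

end SmoothCorner

/-! ### Closed curves positive for a nowhere zero 1-form. -/

section PositiveCurves

open Filter Set

variable {E : Type*} [NormedAddCommGroup E] [NormedSpace ℝ E] {S : Type*} [TopologicalSpace S]
  [ChartedSpace E S]

/-- The curve `γ` is smooth at `t` and its velocity is `β`-positive there. -/
def PositiveAt (β : ∀ q : S, TangentSpace 𝓘(ℝ, E) q →L[ℝ] ℝ) (γ : ℝ → S) (t : ℝ) : Prop :=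
  ContMDiffAt 𝓘(ℝ, ℝ) 𝓘(ℝ, E) ∞ γ t ∧ 0 < β (γ t) (mfderiv 𝓘(ℝ, ℝ) 𝓘(ℝ, E) γ t (1 : ℝ))

variable {β : ∀ q : S, TangentSpace 𝓘(ℝ, E) q →L[ℝ] ℝ} {γ γ' : ℝ → S} {t : ℝ}

theorem PositiveAt.congr (h : PositiveAt β γ t) (hγ : γ' =ᶠ[𝓝 t] γ) : PositiveAt β γ' t := by
  refine ⟨h.1.congr_of_eventuallyEq hγ, ?_⟩
  rw [hγ.mfderiv_eq, hγ.self_of_nhds]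
  exact h.2

theorem PositiveAt.comp_affine {a b : ℝ} (ha : 0 < a) (h : PositiveAt β γ (a * t + b)) :
    PositiveAt β (fun s => γ (a * s + b)) t := by
  have hd : HasDerivAt (fun s : ℝ => a * s + b) a t := by
    simpa using ((hasDerivAt_id t).const_mul a).add_const b
  have hs : ContMDiffAt 𝓘(ℝ, ℝ) 𝓘(ℝ, ℝ) ∞ (fun s : ℝ => a * s + b) t :=
    ContDiffAt.contMDiffAt (by fun_prop)
  refine ⟨ContMDiffAt.comp (g := γ) t h.1 hs, ?_⟩
  have h2 := HasMFDerivAt.comp (g := γ) (f := fun s : ℝ => a * s + b) t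
    (h.1.mdifferentiableAt (by simp)).hasMFDerivAt hd.hasFDerivAt.hasMFDerivAt
  have h3 : mfderiv 𝓘(ℝ, ℝ) 𝓘(ℝ, E) (fun s => γ (a * s + b)) t (1 : ℝ) =
      a • mfderiv 𝓘(ℝ, ℝ) 𝓘(ℝ, E) γ (a * t + b) (1 : ℝ) := by
    have e : ContinuousLinearMap.toSpanSingleton ℝ a (1 : ℝ) = a • (1 : ℝ) := by simp
    exact (DFunLike.congr_fun h2.mfderiv (1 : ℝ)).trans
      ((congrArg (mfderiv 𝓘(ℝ, ℝ) 𝓘(ℝ, E) γ (a * t + b)) e).trans (map_smul _ _ _))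
  rw [h3]
  have := mul_pos ha h.2
  rw [← smul_eq_mul, ← map_smul] at this
  exact this

theorem PositiveAt.add_const {b : ℝ} (h : PositiveAt β γ (t + b)) :
    PositiveAt β (fun s => γ (s + b)) t := by
  have := PositiveAt.comp_affine (β := β) (γ := γ) (a := 1) (b := b) (t := t) one_pos (by simpa)
  simpa using this

/-- The form `β` in the preferred chart at `p`. -/
noncomputable def chartPairing (β : ∀ q : S, TangentSpace 𝓘(ℝ, E) q →L[ℝ] ℝ) (p : S)
    (z : E × E) : ℝ :=
  β ((extChartAt 𝓘(ℝ, E) p).symm z.1)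
    (mfderiv 𝓘(ℝ, E) 𝓘(ℝ, E) (extChartAt 𝓘(ℝ, E) p).symm z.1 z.2)

variable [IsManifold 𝓘(ℝ, E) ∞ S]

theorem continuousOn_chartPairing
    (hβ : Continuous fun v : TangentBundle 𝓘(ℝ, E) S => β v.1 v.2) (p : S) :
    ContinuousOn (chartPairing β p) ((extChartAt 𝓘(ℝ, E) p).target ×ˢ univ) := by
  have hopen := isOpen_extChartAt_target (I := 𝓘(ℝ, E)) p
  have h1 := (contMDiffOn_extChartAt_symm (I := 𝓘(ℝ, E)) (n := ∞) p).continuousOn_tangentMapWithin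
    (by simp) hopen.uniqueMDiffOn
  have h2 := h1.comp (f := fun z : E × E => (tangentBundleModelSpaceHomeomorph 𝓘(ℝ, E)).symm z)
    (tangentBundleModelSpaceHomeomorph 𝓘(ℝ, E)).symm.continuous.continuousOn
    (s := (extChartAt 𝓘(ℝ, E) p).target ×ˢ univ) (fun z hz => hz.1)
  refine (hβ.comp_continuousOn h2).congr fun z hz => ?_
  change _ = β _ (mfderivWithin 𝓘(ℝ, E) 𝓘(ℝ, E) (extChartAt 𝓘(ℝ, E) p).symm
    (extChartAt 𝓘(ℝ, E) p).target z.1 z.2)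
  rw [mfderivWithin_of_isOpen hopen hz.1]
  rfl

theorem positiveAt_chart_symm_comp {p : S} {c : ℝ → E} (hc : ContDiffAt ℝ ∞ c t)
    (hct : c t ∈ (extChartAt 𝓘(ℝ, E) p).target) :
    PositiveAt β ((extChartAt 𝓘(ℝ, E) p).symm ∘ c) t ↔
      0 < chartPairing β p (c t, deriv c t) := by
  have hs : ContMDiffAt 𝓘(ℝ, E) 𝓘(ℝ, E) ∞ (extChartAt 𝓘(ℝ, E) p).symm (c t) :=
    (contMDiffOn_extChartAt_symm p).contMDiffAt ((isOpen_extChartAt_target p).mem_nhds hct)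
  have h2 := HasMFDerivAt.comp t (hs.mdifferentiableAt (by simp)).hasMFDerivAt
    (hc.differentiableAt (by simp)).hasDerivAt.hasFDerivAt.hasMFDerivAt
  have h3 : mfderiv 𝓘(ℝ, ℝ) 𝓘(ℝ, E) ((extChartAt 𝓘(ℝ, E) p).symm ∘ c) t (1 : ℝ) =
      mfderiv 𝓘(ℝ, E) 𝓘(ℝ, E) (extChartAt 𝓘(ℝ, E) p).symm (c t) (deriv c t) := by
    have e : ContinuousLinearMap.toSpanSingleton ℝ (deriv c t) (1 : ℝ) = deriv c t := by simp
    exact (DFunLike.congr_fun h2.mfderiv (1 : ℝ)).trans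
      (congrArg (mfderiv 𝓘(ℝ, E) 𝓘(ℝ, E) (extChartAt 𝓘(ℝ, E) p).symm (c t)) e)
  unfold PositiveAt chartPairing
  rw [h3]
  exact and_iff_right (hs.comp t hc.contMDiffAt)

theorem PositiveAt.chart_comp {p : S} (h : PositiveAt β γ t)
    (hp : γ t ∈ (extChartAt 𝓘(ℝ, E) p).source) :
    ContDiffAt ℝ ∞ (extChartAt 𝓘(ℝ, E) p ∘ γ) t ∧
      0 < chartPairing β p (extChartAt 𝓘(ℝ, E) p (γ t),
        deriv (extChartAt 𝓘(ℝ, E) p ∘ γ) t) := by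
  have hc : ContDiffAt ℝ ∞ (extChartAt 𝓘(ℝ, E) p ∘ γ) t := by
    rw [← contMDiffAt_iff_contDiffAt]
    exact (contMDiffAt_extChartAt' (by rwa [extChartAt_source] at hp)).comp t h.1
  refine ⟨hc, (positiveAt_chart_symm_comp hc ((extChartAt 𝓘(ℝ, E) p).map_source hp)).1
    (h.congr ?_)⟩
  filter_upwards [h.1.continuousAt.preimage_mem_nhds
    ((isOpen_extChartAt_source (I := 𝓘(ℝ, E)) p).mem_nhds hp)] with s hs
  exact (extChartAt 𝓘(ℝ, E) p).left_inv hs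

theorem isOpen_chartPairing_pos
    (hβ : Continuous fun v : TangentBundle 𝓘(ℝ, E) S => β v.1 v.2) (p : S) :
    IsOpen ((extChartAt 𝓘(ℝ, E) p).target ×ˢ univ ∩ chartPairing β p ⁻¹' Ioi 0) :=
  (continuousOn_chartPairing hβ p).isOpen_inter_preimage
    ((isOpen_extChartAt_target p).prod isOpen_univ) isOpen_Ioi

/-- Positivity read in a chart is an open condition on (point, velocity), and at the corner it is
linear in the velocity. This is the setting of `exists_smooth_corner`. -/
theorem exists_positive_corner
    (hβ : Continuous fun v : TangentBundle 𝓘(ℝ, E) S => β v.1 v.2) {γ₁ γ₂ : ℝ → S} {ε : ℝ}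
    (hε : 0 < ε) (h₁ : ∀ t ∈ Ioo (-ε) ε, PositiveAt β γ₁ t)
    (h₂ : ∀ t ∈ Ioo (-ε) ε, PositiveAt β γ₂ t) (h₀ : γ₁ 0 = γ₂ 0) :
    ∃ δ, 0 < δ ∧ δ < ε ∧ ∃ γ : ℝ → S, (∀ t ≤ -δ, γ t = γ₁ t) ∧ (∀ t, δ ≤ t → γ t = γ₂ t) ∧
      ∀ t ∈ Icc (-δ) δ, PositiveAt β γ t := by
  set φ := extChartAt 𝓘(ℝ, E) (γ₁ 0) with hφ
  have h00 : (0 : ℝ) ∈ Ioo (-ε) ε := ⟨by linarith, hε⟩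
  have hsrc : φ.source ∈ 𝓝 (γ₁ 0) := extChartAt_source_mem_nhds _
  have hs₁ : ∀ᶠ t in 𝓝 0, γ₁ t ∈ φ.source := (h₁ 0 h00).1.continuousAt.preimage_mem_nhds hsrc
  have hs₂ : ∀ᶠ t in 𝓝 0, γ₂ t ∈ φ.source :=
    (h₂ 0 h00).1.continuousAt.preimage_mem_nhds (h₀ ▸ hsrc)
  have hI : ∀ᶠ t : ℝ in 𝓝 0, t ∈ Ioo (-ε) ε := Ioo_mem_nhds h00.1 h00.2
  obtain ⟨r, hr, hball⟩ := Metric.eventually_nhds_iff.1 (hs₁.and (hs₂.and hI))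
  have hrr : ∀ t ∈ Ioo (-r) r, γ₁ t ∈ φ.source ∧ γ₂ t ∈ φ.source ∧ t ∈ Ioo (-ε) ε := fun t ht =>
    hball (by rw [Real.dist_eq, sub_zero, abs_lt]; exact ht)
  obtain ⟨δ, hδ, hδr, c, hc₁, hc₂, hc⟩ := exists_smooth_corner (c₁ := φ ∘ γ₁) (c₂ := φ ∘ γ₂)
    (by filter_upwards [hs₁, hI] with t ht ht' using ((h₁ t ht').chart_comp ht).1)
    (by filter_upwards [hs₂, hI] with t ht ht' using ((h₂ t ht').chart_comp ht).1)
    (by simp [h₀]) (isOpen_chartPairing_pos hβ (γ₁ 0))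
    ((β (φ.symm (φ (γ₁ 0)))).comp (mfderiv 𝓘(ℝ, E) 𝓘(ℝ, E) φ.symm (φ (γ₁ 0)))).toLinearMap
    (fun w hw => ⟨⟨mem_extChartAt_target _, trivial⟩, hw⟩)
    ((h₁ 0 h00).chart_comp (mem_of_mem_nhds hsrc)).2
    (by rw [h₀]; exact ((h₂ 0 h00).chart_comp (hs₂.self_of_nhds)).2)
    (lt_min hε hr)
  have hδr' := hδr.trans_le (min_le_right _ _)
  -- On all of (-r, r), not just on [-δ, δ], the case distinction collapses to the chart curve. This
  -- gives smoothness at the junctions ±δ.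
  have hev : ∀ t ∈ Ioo (-r) r, (if t ∈ Icc (-δ) δ then φ.symm (c t) else
      if t ≤ 0 then γ₁ t else γ₂ t) = φ.symm (c t) := by
    intro t ht
    obtain ⟨k1, k2, -⟩ := hrr t ht
    split_ifs with h h'
    · rfl
    · have : t ≤ -δ := by by_contra hh; exact h ⟨by linarith, by linarith⟩
      rw [hc₁ t this]; exact (φ.left_inv k1).symm
    · have : δ ≤ t := by by_contra hh; exact h ⟨by linarith, by linarith⟩
      rw [hc₂ t this]; exact (φ.left_inv k2).symm
  refine ⟨δ, hδ, hδr.trans_le (min_le_left _ _), fun t => if t ∈ Icc (-δ) δ then φ.symm (c t) else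
    if t ≤ 0 then γ₁ t else γ₂ t, fun t ht => ?_, fun t ht => ?_, fun t ht => ?_⟩
  · rcases eq_or_lt_of_le ht with rfl | hlt
    · have hm : -δ ∈ Ioo (-r) r := ⟨by linarith, by linarith⟩
      dsimp only
      rw [hev _ hm, hc₁ _ le_rfl]; exact φ.left_inv (hrr _ hm).1
    · have : t ∉ Icc (-δ) δ := fun h => by linarith [h.1]
      simp only [this, if_false, if_pos (by linarith : t ≤ 0)]
  · rcases eq_or_lt_of_le ht with rfl | hlt
    · have hm : δ ∈ Ioo (-r) r := ⟨by linarith, by linarith⟩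
      dsimp only
      rw [hev _ hm, hc₂ _ le_rfl]; exact φ.left_inv (hrr _ hm).2.1
    · have : t ∉ Icc (-δ) δ := fun h => by linarith [h.2]
      simp only [this, if_false, if_neg (by linarith : ¬ t ≤ 0)]
  · obtain ⟨k1, k2, k3⟩ := hc t ht
    refine PositiveAt.congr ((positiveAt_chart_symm_comp k1 k2.1).2 k3) ?_
    filter_upwards [Ioo_mem_nhds (show -r < t by linarith [ht.1]) (show t < r by linarith [ht.2])]
      with s hs using hev s hs

/-- There is a `β`-positive curve from `x` to `y`. -/
def PositivelyReaches (β : ∀ q : S, TangentSpace 𝓘(ℝ, E) q →L[ℝ] ℝ) (x y : S) : Prop :=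
  ∃ (γ : ℝ → S) (T ε : ℝ), 0 < T ∧ 0 < ε ∧ γ 0 = x ∧ γ T = y ∧
    ∀ t ∈ Ioo (-ε) (T + ε), PositiveAt β γ t

/-- The curves extend past both endpoints by some ε, so near the junction each is defined on both
sides and the corner can be rounded there. -/
theorem PositivelyReaches.trans
    (hβ : Continuous fun v : TangentBundle 𝓘(ℝ, E) S => β v.1 v.2) {x y z : S}
    (hxy : PositivelyReaches β x y) (hyz : PositivelyReaches β y z) :
    PositivelyReaches β x z := by
  obtain ⟨γ₁, T₁, ε₁, hT₁, hε₁, h10, h1T, h1⟩ := hxy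
  obtain ⟨γ₂, T₂, ε₂, hT₂, hε₂, h20, h2T, h2⟩ := hyz
  obtain ⟨ε, hε, hle⟩ : ∃ ε > 0, ε ≤ ε₁ ∧ ε ≤ ε₂ ∧ ε ≤ T₁ ∧ ε ≤ T₂ :=
    ⟨min (min ε₁ ε₂) (min T₁ T₂), by positivity, by simp, by simp, by simp, by simp⟩
  obtain ⟨hle1, hle2, hle3, hle4⟩ := hle
  obtain ⟨δ, hδ, hδε, γ, hγ₁, hγ₂, hγ⟩ := exists_positive_corner hβ
    (γ₁ := fun s => γ₁ (s + T₁)) (γ₂ := γ₂) hε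
    (fun t ht => PositiveAt.add_const (h1 _ ⟨by linarith [ht.1], by linarith [ht.2]⟩))
    (fun t ht => h2 _ ⟨by linarith [ht.1], by linarith [ht.2]⟩) (by simp [h1T, h20])
  refine ⟨fun s => γ (s + -T₁), T₁ + T₂, ε, by linarith, hε, ?_, ?_, fun t ht => ?_⟩
  · dsimp only
    rw [hγ₁ _ (by linarith)]; simpa using h10
  · dsimp only
    rw [hγ₂ _ (by linarith)]; simpa using h2T
  apply PositiveAt.add_const
  rcases lt_or_ge (t + -T₁) (-δ) with h | h
  · refine (PositiveAt.add_const (h1 _ ⟨?_, ?_⟩)).congr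
      (by filter_upwards [Iio_mem_nhds h] with s hs using hγ₁ s (le_of_lt hs)) <;>
    linarith [ht.1]
  rcases le_or_gt (t + -T₁) δ with h' | h'
  · exact hγ _ ⟨h, h'⟩
  · refine (h2 _ ⟨?_, ?_⟩).congr
      (by filter_upwards [Ioi_mem_nhds h'] with s hs using hγ₂ s (le_of_lt hs)) <;>
    linarith [ht.2]

/-- The corner between the end of the curve and its own beginning is rounded, the result is extended
periodically, and time is rescaled to period 1. -/
theorem PositivelyReaches.exists_periodic
    (hβ : Continuous fun v : TangentBundle 𝓘(ℝ, E) S => β v.1 v.2) {x : S}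
    (hx : PositivelyReaches β x x) :
    ∃ γ : ℝ → S, Function.Periodic γ 1 ∧ ∀ t, PositiveAt β γ t := by
  obtain ⟨γ₁, T, ε₁, hT, hε₁, h10, h1T, h1⟩ := hx
  -- The bound T/4 forces δ < T/4, so the rounded curve on (-3T/4, 3T/4) agrees with its translate
  -- by T on the whole overlap.
  obtain ⟨ε, hε, hle1, hle2⟩ : ∃ ε > 0, ε ≤ ε₁ ∧ ε ≤ T / 4 :=
    ⟨min ε₁ (T / 4), by positivity, by simp, by simp⟩
  obtain ⟨δ, hδ, hδε, η, hη₁, hη₂, hη⟩ := exists_positive_corner hβ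
    (γ₁ := fun s => γ₁ (s + T)) (γ₂ := γ₁) hε
    (fun t ht => PositiveAt.add_const (h1 _ ⟨by linarith [ht.1], by linarith [ht.2]⟩))
    (fun t ht => h1 _ ⟨by linarith [ht.1], by linarith [ht.2]⟩) (by simp [h1T, h10])
  have hpos : ∀ t ∈ Ioo (-(3 * T / 4)) (3 * T / 4), PositiveAt β η t := by
    intro t ht
    rcases lt_or_ge t (-δ) with h | h
    · refine (PositiveAt.add_const (h1 _ ⟨?_, ?_⟩)).congr
        (by filter_upwards [Iio_mem_nhds h] with s hs using hη₁ s (le_of_lt hs)) <;>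
      linarith [ht.1]
    rcases le_or_gt t δ with h' | h'
    · exact hη _ ⟨h, h'⟩
    · refine (h1 _ ⟨?_, ?_⟩).congr
        (by filter_upwards [Ioi_mem_nhds h'] with s hs using hη₂ s (le_of_lt hs)) <;>
      linarith [ht.2]
  have hshift : ∀ t ∈ Icc δ (T - δ), η (t - T) = η t := by
    intro t ht
    rw [hη₂ t ht.1, hη₁ _ (by linarith [ht.2])]
    simp
  set o : ℝ → S := fun t => η (toIcoMod hT (-(T / 2)) t) with ho
  have hper : Function.Periodic o T := fun t => by simp [ho]
  have hoeq : ∀ t ∈ Ioo (-(3 * T / 4)) (3 * T / 4), o t = η t := by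
    intro t ht
    simp only [ho]
    rcases lt_or_ge t (-(T / 2)) with h | h
    · have : toIcoMod hT (-(T / 2)) t = t + T := by
        rw [← toIcoMod_add_right, toIcoMod_eq_self]; constructor <;> linarith [ht.1]
      rw [this, ← hshift (t + T) ⟨by linarith [ht.1], by linarith⟩]; simp
    rcases lt_or_ge t (T / 2) with h' | h'
    · rw [(toIcoMod_eq_self hT).2 ⟨h, by linarith⟩]
    · have : toIcoMod hT (-(T / 2)) t = t - T := by
        rw [← toIcoMod_sub, toIcoMod_eq_self]; constructor <;> linarith [ht.2]
      rw [this, hshift t ⟨by linarith, by linarith [ht.2]⟩]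
  have hopos : ∀ t, PositiveAt β o t := by
    intro t
    have hm := toIcoMod_mem_Ico hT (-(T / 2)) t
    have h0 : PositiveAt β o (toIcoMod hT (-(T / 2)) t) := by
      refine (hpos _ ⟨by linarith [hm.1], by linarith [hm.2]⟩).congr ?_
      filter_upwards [Ioo_mem_nhds (show -(3 * T / 4) < toIcoMod hT (-(T / 2)) t by linarith [hm.1])
        (show toIcoMod hT (-(T / 2)) t < 3 * T / 4 by linarith [hm.2])] with s hs using hoeq s hs
    rw [toIcoMod, sub_eq_add_neg] at h0
    refine h0.add_const.congr (Eventually.of_forall fun s => ?_)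
    dsimp only
    rw [← sub_eq_add_neg, hper.sub_zsmul_eq]
  refine ⟨fun s => o (T * s), fun t => ?_, fun t => ?_⟩
  · dsimp only
    rw [mul_add, mul_one, hper]
  · have := PositiveAt.comp_affine (β := β) (γ := o) (b := 0) (t := t) hT (hopos _)
    simpa using this

/-- In a chart, start at φ(p) - τv with β(v) > 0. The segment reaching a point y near p in time τ
has velocity close to v, so it is positive too. -/
theorem exists_reaches_nhds
    (hβ : Continuous fun v : TangentBundle 𝓘(ℝ, E) S => β v.1 v.2) (p : S) (hp : β p ≠ 0) :
    ∃ x, ∀ᶠ y in 𝓝 p, PositivelyReaches β x y := by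
  set φ := extChartAt 𝓘(ℝ, E) p with hφ
  obtain ⟨v, hv⟩ : ∃ v : E, 0 < chartPairing β p (φ p, v) := by
    obtain ⟨v, hv⟩ : ∃ v, 0 < β p v := by
      by_contra! hcon
      refine hp (ContinuousLinearMap.ext fun v => le_antisymm (hcon v) ?_)
      have := hcon (-v)
      rw [map_neg] at this
      simpa using this
    have : IsManifold 𝓘(ℝ, E) 1 S := .of_le (n := ∞) (by simp)
    have h1 := mfderivWithin_range_extChartAt_symm (I := 𝓘(ℝ, E)) (x := p)
    rw [ModelWithCorners.range_eq_univ, mfderivWithin_univ] at h1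
    refine ⟨v, ?_⟩
    unfold chartPairing
    dsimp only
    rw [hφ, h1, extChartAt_to_inv]
    exact hv
  obtain ⟨r, hr, hball⟩ := Metric.isOpen_iff.1 (isOpen_chartPairing_pos hβ p) (φ p, v)
    ⟨⟨mem_extChartAt_target _, trivial⟩, hv⟩
  have hgood : ∀ y w, dist y (φ p) < r → dist w v < r → y ∈ φ.target ∧
      0 < chartPairing β p (y, w) := fun y w hy hw => by
    have := hball (show (y, w) ∈ Metric.ball (φ p, v) r from by
      rw [Metric.mem_ball, Prod.dist_eq]; exact max_lt hy hw)
    exact ⟨this.1.1, this.2⟩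
  obtain ⟨τ, hτ, hτr⟩ : ∃ τ : ℝ, 0 < τ ∧ τ * ‖v‖ < r := by
    refine ⟨r / (‖v‖ + 1), by positivity, ?_⟩
    rw [div_mul_eq_mul_div, div_lt_iff₀ (by positivity)]
    nlinarith [norm_nonneg v]
  have hz : dist (φ p - τ • v) (φ p) < r := by
    rw [dist_eq_norm]
    simpa [norm_smul, abs_of_pos hτ] using hτr
  have hev : ∀ᶠ y in 𝓝 p, y ∈ φ.source ∧ dist (φ y) (φ p) < r ∧
      dist (τ⁻¹ • (φ y - (φ p - τ • v))) v < r := by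
    refine (show ∀ᶠ y in 𝓝 p, y ∈ φ.source from extChartAt_source_mem_nhds p).and ?_
    have hc := continuousAt_extChartAt (I := 𝓘(ℝ, E)) p
    refine (hc.eventually (Metric.ball_mem_nhds _ hr)).and ?_
    have hc2 : ContinuousAt (fun y => τ⁻¹ • (φ y - (φ p - τ • v))) p :=
      (hc.sub continuousAt_const).const_smul _
    refine hc2.eventually (Metric.isOpen_ball.mem_nhds ?_)
    simpa [smul_smul, inv_mul_cancel₀ hτ.ne'] using hr
  refine ⟨φ.symm (φ p - τ • v), hev.mono fun y ⟨hy, hy1, hy2⟩ => ?_⟩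
  set z := φ p - τ • v with hzdef
  set w := τ⁻¹ • (φ y - z) with hwdef
  have hw : ∀ t ∈ Icc (0 : ℝ) τ, dist (z + t • w) (φ p) < r := by
    intro t ht
    have hmem := (convex_ball (φ p) r).add_smul_sub_mem (Metric.mem_ball.2 hz)
      (Metric.mem_ball.2 hy1) (t := t / τ) ⟨div_nonneg ht.1 hτ.le, div_le_one_of_le₀ ht.2 hτ.le⟩
    rw [hwdef, smul_smul, ← div_eq_mul_inv]
    exact hmem
  have hcont : Continuous fun t : ℝ => dist (z + t • w) (φ p) := by fun_prop
  have hopen : IsOpen {t : ℝ | dist (z + t • w) (φ p) < r} := isOpen_lt hcont continuous_const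
  obtain ⟨e, he, hsub⟩ := isCompact_Icc.exists_thickening_subset_open hopen hw
  refine ⟨φ.symm ∘ fun t => z + t • w, τ, e, hτ, he, by simp, ?_, fun t ht => ?_⟩
  · simp only [Function.comp_apply, hwdef, smul_smul, mul_inv_cancel₀ hτ.ne', one_smul,
      add_sub_cancel]
    exact φ.left_inv hy
  · have ht' : dist (z + t • w) (φ p) < r := by
      refine hsub (Metric.mem_thickening_iff.2 ⟨max 0 (min t τ), ⟨by simp, by simp [hτ.le]⟩, ?_⟩)
      rw [Real.dist_eq, abs_lt]
      rcases le_total t τ with h | h <;> rcases le_total 0 t with h' | h' <;>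
        simp only [min_eq_left, min_eq_right, max_eq_left, max_eq_right, h, h', hτ.le] <;>
        constructor <;> linarith [ht.1, ht.2]
    have hd : HasDerivAt (fun t : ℝ => z + t • w) w t := by
      simpa using ((hasDerivAt_id t).smul_const w).const_add z
    have hg := hgood _ w ht' hy2
    refine (positiveAt_chart_symm_comp (p := p) (c := fun t : ℝ => z + t • w) (by fun_prop)
      hg.1).2 ?_
    rw [hd.deriv]
    exact hg.2

/-- A nowhere vanishing 1-form on a compact manifold admits a closed positive curve. -/
theorem exists_periodic_positive [CompactSpace S] [Nonempty S]
    (hβ : Continuous fun v : TangentBundle 𝓘(ℝ, E) S => β v.1 v.2) (hne : ∀ p, β p ≠ 0) :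
    ∃ γ : ℝ → S, Function.Periodic γ 1 ∧ ∀ t, PositiveAt β γ t := by
  choose x hx using fun p => exists_reaches_nhds hβ p (hne p)
  obtain ⟨F, hF⟩ := CompactSpace.elim_nhds_subcover
    (fun p => {y | PositivelyReaches β (x p) y}) hx
  have hpred : ∀ y : S, ∃ q ∈ F, PositivelyReaches β (x q) y := fun y => by
    have : y ∈ (⊤ : Set S) := trivial
    rw [← hF] at this
    simpa using this
  by_contra hcon
  have hirr : ∀ y, ¬ PositivelyReaches β y y := fun y hy => hcon (hy.exists_periodic hβ)
  have : IsTrans F fun a b => PositivelyReaches β (x a) (x b) := ⟨fun _ _ _ h h' => h.trans hβ h'⟩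
  have : Std.Irrefl fun a b : F => PositivelyReaches β (x a) (x b) := ⟨fun _ => hirr _⟩
  -- If no point reached itself, reachability among the finitely many starting points would be a
  -- well-founded order. Its minimal element is however reached from another starting point.
  have hwf := Finite.wellFounded_of_trans_of_irrefl
    fun a b : F => PositivelyReaches β (x a) (x b)
  obtain ⟨q₀, hq₀, -⟩ := hpred (Classical.arbitrary S)
  obtain ⟨m, -, hm⟩ := hwf.has_min univ ⟨⟨q₀, hq₀⟩, trivial⟩
  obtain ⟨q, hq, hqm⟩ := hpred (x m)
  exact hm ⟨q, hq⟩ trivial hqm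

end PositiveCurves

/-! ### Global primitives on the square and maxima on the sphere. -/

section LocalPrimitives

open Filter Set

/-- `F` agrees on `A` near each point `a ∈ A` with the function `G a`, up to a constant. -/
def IsPrimitiveOn {K : Type*} [TopologicalSpace K] (G : K → K → ℝ) (F : K → ℝ) (A : Set K) :
    Prop :=
  ∀ a ∈ A, ∀ᶠ b in 𝓝[A] a, F b - F a = G a b - G a a

/-- The functions `G a`, each considered near `a`, agree locally up to constants. -/
def LocallyCompatible {K : Type*} [TopologicalSpace K] (G : K → K → ℝ) : Prop :=
  ∀ a, ∀ᶠ b in 𝓝 a, ∀ᶠ c in 𝓝 b, G a c - G a b = G b c - G b b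

theorem LocallyCompatible.comp {K X : Type*} [TopologicalSpace K] [TopologicalSpace X]
    {G : X → X → ℝ} (hG : LocallyCompatible G) {q : K → X} (hq : Continuous q) :
    LocallyCompatible fun a b => G (q a) (q b) := fun a =>
  (hq.continuousAt.eventually (hG (q a))).mono fun _ hb => hq.continuousAt.eventually hb

variable {K : Type*} [TopologicalSpace K] {G : K → K → ℝ}

theorem IsPrimitiveOn.mono {F : K → ℝ} {A B : Set K} (h : IsPrimitiveOn G F B) (hAB : A ⊆ B) :
    IsPrimitiveOn G F A :=
  fun a ha => (h a (hAB ha)).filter_mono (nhdsWithin_mono a hAB)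

/-- On the connected overlap the two primitives differ by a constant, which is absorbed into the
second. Closedness of `A` and `B` means that near a point outside one of them that piece imposes no
condition. -/
theorem IsPrimitiveOn.exists_union {F₁ F₂ : K → ℝ} {A B : Set K} (h₁ : IsPrimitiveOn G F₁ A)
    (h₂ : IsPrimitiveOn G F₂ B) (hA : IsClosed A) (hB : IsClosed B)
    (hAB : IsPreconnected (A ∩ B)) : ∃ F, IsPrimitiveOn G F (A ∪ B) := by
  classical
  have hconst : ∀ x ∈ A ∩ B, ∀ y ∈ A ∩ B, F₁ x - F₂ x = F₁ y - F₂ y := by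
    intro x hx y hy
    refine hAB.induction₂ (fun x y => F₁ x - F₂ x = F₁ y - F₂ y) (fun a ha => ?_)
      (fun _ _ _ _ _ _ => Eq.trans) (fun _ _ _ _ => Eq.symm) hx hy
    filter_upwards [(h₁ a ha.1).filter_mono (nhdsWithin_mono a inter_subset_left),
      (h₂ a ha.2).filter_mono (nhdsWithin_mono a inter_subset_right)] with b hb hb'
    linarith
  obtain ⟨c, hc⟩ : ∃ c, ∀ x ∈ A ∩ B, F₁ x = F₂ x + c := by
    rcases (A ∩ B).eq_empty_or_nonempty with h | ⟨x, hx⟩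
    · exact ⟨0, by simp [h]⟩
    · exact ⟨F₁ x - F₂ x, fun y hy => by linarith [hconst x hx y hy]⟩
  refine ⟨fun x => if x ∈ A then F₁ x else F₂ x + c, fun a ha => ?_⟩
  have hFA : ∀ x ∈ A, (if x ∈ A then F₁ x else F₂ x + c) = F₁ x := fun x hx => if_pos hx
  have hFB : ∀ x ∈ B, (if x ∈ A then F₁ x else F₂ x + c) = F₂ x + c := fun x hx => by
    split_ifs with h
    · exact hc x ⟨h, hx⟩
    · rfl
  rw [nhdsWithin_union, eventually_sup]
  constructor
  · by_cases haA : a ∈ A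
    · filter_upwards [h₁ a haA, self_mem_nhdsWithin] with b hb hbA
      rw [hFA b hbA, hFA a haA, hb]
    · rw [notMem_closure_iff_nhdsWithin_eq_bot.1 (by rwa [hA.closure_eq])]
      exact eventually_bot
  · by_cases haB : a ∈ B
    · filter_upwards [h₂ a haB, self_mem_nhdsWithin] with b hb hbB
      rw [hFB b hbB, hFB a haB, ← hb]
      ring
    · rw [notMem_closure_iff_nhdsWithin_eq_bot.1 (by rwa [hB.closure_eq])]
      exact eventually_bot

open unitInterval in
-- A fine grid puts each cell inside one domain of definition. Cells are glued into rows and rows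
-- into the square, every overlap being a product of intervals.
theorem LocallyCompatible.exists_isPrimitiveOn_square {G : I × I → I × I → ℝ}
    (hG : LocallyCompatible G) : ∃ F, IsPrimitiveOn G F univ := by
  have hloc : ∀ a, ∃ U, IsOpen U ∧ a ∈ U ∧ IsPrimitiveOn G (G a) U := fun a => by
    obtain ⟨U, hU, hUo, haU⟩ := eventually_nhds_iff.1 (hG a)
    exact ⟨U, hUo, haU, fun b hb => (hU b hb).filter_mono nhdsWithin_le_nhds⟩
  choose U hUo haU hU using hloc
  obtain ⟨t, ht0, htm, ⟨N, hN⟩, ht⟩ := exists_monotone_Icc_subset_open_cover_unitInterval_prod_self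
    hUo (fun a _ => mem_iUnion.2 ⟨a, haU a⟩)
  have hcell : ∀ n m, ∃ F, IsPrimitiveOn G F (Icc (t n) (t (n + 1)) ×ˢ Icc (t m) (t (m + 1))) :=
    fun n m => by
      obtain ⟨a, ha⟩ := ht n m
      exact ⟨G a, (hU a).mono ha⟩
  have hunion : ∀ n, Icc 0 (t n) ∪ Icc (t n) (t (n + 1)) = Icc 0 (t (n + 1)) := fun n =>
    Icc_union_Icc_eq_Icc (ht0 ▸ htm (Nat.zero_le n)) (htm n.le_succ)
  have hinter : ∀ n, IsPreconnected (Icc 0 (t n) ∩ Icc (t n) (t (n + 1))) := fun n => by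
    rw [Icc_inter_Icc]; exact isPreconnected_Icc
  have hrow : ∀ m n, ∃ F, IsPrimitiveOn G F (Icc 0 (t n) ×ˢ Icc (t m) (t (m + 1))) := by
    intro m n
    induction n with
    | zero =>
      obtain ⟨F, hF⟩ := hcell 0 m
      exact ⟨F, hF.mono (prod_mono (Icc_subset_Icc ht0.le (htm (Nat.zero_le 1))) subset_rfl)⟩
    | succ n ih =>
      obtain ⟨F₁, hF₁⟩ := ih
      obtain ⟨F₂, hF₂⟩ := hcell n m
      rw [← hunion n, union_prod]
      refine hF₁.exists_union hF₂ (isClosed_Icc.prod isClosed_Icc) (isClosed_Icc.prod isClosed_Icc)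
        ?_
      rw [prod_inter_prod, inter_self]
      exact (hinter n).prod isPreconnected_Icc
  have hcol : ∀ m, ∃ F, IsPrimitiveOn G F (Icc 0 (t N) ×ˢ Icc 0 (t m)) := by
    intro m
    induction m with
    | zero =>
      obtain ⟨F, hF⟩ := hrow 0 N
      exact ⟨F, hF.mono (prod_mono subset_rfl (Icc_subset_Icc ht0.le (htm (Nat.zero_le 1))))⟩
    | succ m ih =>
      obtain ⟨F₁, hF₁⟩ := ih
      obtain ⟨F₂, hF₂⟩ := hrow m N
      rw [← hunion m, prod_union]
      refine hF₁.exists_union hF₂ (isClosed_Icc.prod isClosed_Icc) (isClosed_Icc.prod isClosed_Icc)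
        ?_
      rw [prod_inter_prod, inter_self]
      exact isPreconnected_Icc.prod (hinter m)
  obtain ⟨F, hF⟩ := hcol N
  refine ⟨F, hF.mono fun a _ => ?_⟩
  rw [hN N le_rfl]
  exact ⟨⟨nonneg', le_one'⟩, ⟨nonneg', le_one'⟩⟩

open unitInterval in
/-- On a space obtained from the square by collapsing the top and the bottom sides and gluing the
left side to the right one, a compatible system of local functions has a local maximum. -/
theorem LocallyCompatible.exists_localMax_of_square {X : Type*} [TopologicalSpace X] [T2Space X]
    {g : X → X → ℝ} (hg : LocallyCompatible g)
    (hgc : ∀ x, ContinuousAt (g x) x) {q : I × I → X} (hq : Continuous q)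
    (hsurj : Function.Surjective q) (h0 : ∀ s, q (s, 0) = q (0, 0)) (h1 : ∀ s, q (s, 1) = q (0, 1))
    (hside : ∀ t, q (0, t) = q (1, t))
    (hinj : ∀ a b, q a = q b → a = b ∨ a.2 = b.2 ∧
      (a.2 = 0 ∨ a.2 = 1 ∨ (a.1 = 0 ∧ b.1 = 1) ∨ (a.1 = 1 ∧ b.1 = 0))) :
    ∃ x, ∀ᶠ y in 𝓝 x, g x y ≤ g x x := by
  obtain ⟨F, hF⟩ := (hg.comp hq).exists_isPrimitiveOn_square
  replace hF : ∀ a, ∀ᶠ b in 𝓝 a, F b - F a = g (q a) (q b) - g (q a) (q a) := fun a => by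
    simpa using hF a trivial
  have hconst : ∀ f : I → ℝ, (∀ a, ∀ᶠ b in 𝓝 a, f a = f b) → ∀ a b, f a = f b := by
    intro f hf a b
    refine isPreconnected_univ.induction₂ (fun x y => f x = f y) (fun a _ => ?_)
      (fun _ _ _ _ _ _ => Eq.trans) (fun _ _ _ _ => Eq.symm) (mem_univ a) (mem_univ b)
    simpa using hf a
  have hF0 : ∀ s s', F (s, 0) = F (s', 0) := hconst _ fun a => by
    have hc : ContinuousAt (fun s : I => (s, (0 : I))) a := by fun_prop
    filter_upwards [hc.eventually (hF (a, 0))] with b hb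
    rw [h0 a, h0 b] at hb
    linarith
  have hF1 : ∀ s s', F (s, 1) = F (s', 1) := hconst _ fun a => by
    have hc : ContinuousAt (fun s : I => (s, (1 : I))) a := by fun_prop
    filter_upwards [hc.eventually (hF (a, 1))] with b hb
    rw [h1 a, h1 b] at hb
    linarith
  -- The two vertical sides have the same image, so `F` differs on them by a constant. It is zero
  -- because the side t = 0 is collapsed.
  have hFs : ∀ t, F (0, t) = F (1, t) := fun t => by
    have := hconst (fun t => F (0, t) - F (1, t)) (fun a => by
      have hc : ContinuousAt (fun s : I => ((0 : I), s)) a := by fun_prop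
      have hc' : ContinuousAt (fun s : I => ((1 : I), s)) a := by fun_prop
      filter_upwards [hc.eventually (hF (0, a)), hc'.eventually (hF (1, a))] with b hb hb'
      rw [hside a, hside b] at hb
      linarith) t 0
    rw [hF0 0 1] at this
    linarith
  have hfib : ∀ a b, q a = q b → F a = F b := by
    rintro ⟨s, t⟩ ⟨s', t'⟩ hab
    rcases hinj _ _ hab with h | ⟨h, h'⟩
    · rw [h]
    · dsimp only at h h'
      subst h
      rcases h' with rfl | rfl | ⟨rfl, rfl⟩ | ⟨rfl, rfl⟩
      exacts [hF0 _ _, hF1 _ _, hFs _, (hFs _).symm]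
  have hFc : Continuous F := by
    rw [continuous_iff_continuousAt]
    intro a
    have hc : ContinuousAt (fun b => g (q a) (q b) - g (q a) (q a) + F a) a :=
      (((hgc (q a)).comp hq.continuousAt).sub continuousAt_const).add continuousAt_const
    exact hc.congr ((hF a).mono fun b hb => by linarith)
  obtain ⟨z, -, hz⟩ := isCompact_univ.exists_isMaxOn univ_nonempty hFc.continuousOn
  refine ⟨q z, ?_⟩
  -- Since `F` is constant on fibres, every point over `q z` is also a maximum of `F`. As `q` is
  -- closed, the inequality near the whole fibre descends to a neighbourhood of `q z`.
  have := hq.isClosedMap.eventually_nhds_fiber (p := fun b => g (q z) (q b) ≤ g (q z) (q z)) (q z)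
    fun z' hz' => by
      have hz' : q z' = q z := hz'
      filter_upwards [hF z'] with b hb
      have : F b ≤ F z := hz (mem_univ b)
      rw [hfib z' z hz', hz'] at hb
      linarith
  filter_upwards [this] with y hy
  obtain ⟨b, rfl⟩ := hsurj y
  exact hy b rfl

open unitInterval in
/-- Spherical coordinates on the unit sphere. -/
noncomputable def sphericalCoord (a : I × I) : Metric.sphere (0 : EuclideanSpace ℝ (Fin 3)) 1 :=
  ⟨!₂[Real.sin (Real.pi * a.2) * Real.cos (2 * Real.pi * a.1),
      Real.sin (Real.pi * a.2) * Real.sin (2 * Real.pi * a.1), Real.cos (Real.pi * a.2)], by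
    rw [mem_sphere_zero_iff_norm, EuclideanSpace.norm_eq, Real.sqrt_eq_one, Fin.sum_univ_three]
    simp only [Real.norm_eq_abs, sq_abs, Matrix.cons_val]
    nlinarith [Real.sin_sq_add_cos_sq (Real.pi * a.2), Real.sin_sq_add_cos_sq (2 * Real.pi * a.1)]⟩

open unitInterval in
theorem sphericalCoord_eq_iff (a b : I × I) : sphericalCoord a = sphericalCoord b ↔
    Real.sin (Real.pi * a.2) * Real.cos (2 * Real.pi * a.1) =
      Real.sin (Real.pi * b.2) * Real.cos (2 * Real.pi * b.1) ∧
    Real.sin (Real.pi * a.2) * Real.sin (2 * Real.pi * a.1) =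
      Real.sin (Real.pi * b.2) * Real.sin (2 * Real.pi * b.1) ∧
    Real.cos (Real.pi * a.2) = Real.cos (Real.pi * b.2) := by
  rw [Subtype.ext_iff]
  constructor
  · intro h
    exact ⟨by simpa [sphericalCoord] using congrArg (fun v : EuclideanSpace ℝ (Fin 3) => v 0) h,
      by simpa [sphericalCoord] using congrArg (fun v : EuclideanSpace ℝ (Fin 3) => v 1) h,
      by simpa [sphericalCoord] using congrArg (fun v : EuclideanSpace ℝ (Fin 3) => v 2) h⟩
  · rintro ⟨h0, h1, h2⟩
    simp only [sphericalCoord, h0, h1, h2]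

theorem continuous_sphericalCoord : Continuous sphericalCoord := by
  refine Continuous.subtype_mk ((PiLp.continuous_toLp 2 _).comp (continuous_pi fun i => ?_)) _
  fin_cases i <;> simp <;> fun_prop

theorem surjective_sphericalCoord : Function.Surjective sphericalCoord := by
  rintro ⟨v, hv⟩
  rw [mem_sphere_zero_iff_norm, EuclideanSpace.norm_eq, Real.sqrt_eq_one, Fin.sum_univ_three] at hv
  simp only [Real.norm_eq_abs, sq_abs] at hv
  have hpi := Real.pi_pos
  have hz1 : -1 ≤ v 2 := by nlinarith [sq_nonneg (v 0), sq_nonneg (v 1)]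
  have hz2 : v 2 ≤ 1 := by nlinarith [sq_nonneg (v 0), sq_nonneg (v 1)]
  have hr : ‖(⟨v 0, v 1⟩ : ℂ)‖ = √(1 - v 2 ^ 2) := by
    rw [Complex.norm_def, Complex.normSq_mk]; congr 1; linarith
  obtain ⟨s, hs0, hs1, hs⟩ : ∃ s : ℝ, 0 ≤ s ∧ s ≤ 1 ∧
      Real.cos (2 * Real.pi * s) = Real.cos (Complex.arg ⟨v 0, v 1⟩) ∧
      Real.sin (2 * Real.pi * s) = Real.sin (Complex.arg ⟨v 0, v 1⟩) := by
    have h1 := Complex.neg_pi_lt_arg ⟨v 0, v 1⟩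
    have h2 := Complex.arg_le_pi ⟨v 0, v 1⟩
    rcases le_total 0 (Complex.arg ⟨v 0, v 1⟩) with h | h
    · refine ⟨Complex.arg ⟨v 0, v 1⟩ / (2 * Real.pi), by positivity, ?_, ?_⟩
      · rw [div_le_one (by positivity)]; linarith
      · rw [mul_div_cancel₀ _ (by positivity)]; simp
    · refine ⟨(Complex.arg ⟨v 0, v 1⟩ + 2 * Real.pi) / (2 * Real.pi),
        div_nonneg (by linarith) (by positivity), ?_, ?_⟩
      · rw [div_le_one (by positivity)]; linarith
      · rw [mul_div_cancel₀ _ (by positivity)]; simp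
  refine ⟨(⟨s, hs0, hs1⟩, ⟨Real.arccos (v 2) / Real.pi, div_nonneg (Real.arccos_nonneg _) hpi.le,
    (div_le_one hpi).2 (Real.arccos_le_pi _)⟩), Subtype.ext ?_⟩
  have e0 := Complex.norm_mul_cos_arg ⟨v 0, v 1⟩
  have e1 := Complex.norm_mul_sin_arg ⟨v 0, v 1⟩
  rw [hr] at e0 e1
  ext i
  fin_cases i <;> simp [sphericalCoord, mul_div_cancel₀ _ hpi.ne', Real.sin_arccos, Real.cos_arccos,
    hz1, hz2, hs, e0, e1]

open unitInterval in
theorem eq_or_of_sphericalCoord_eq (a b : I × I) (h : sphericalCoord a = sphericalCoord b) :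
    a = b ∨ a.2 = b.2 ∧ (a.2 = 0 ∨ a.2 = 1 ∨ (a.1 = 0 ∧ b.1 = 1) ∨ (a.1 = 1 ∧ b.1 = 0)) := by
  obtain ⟨⟨s, hs0, hs1⟩, ⟨t, ht0, ht1⟩⟩ := a
  obtain ⟨⟨s', hs0', hs1'⟩, ⟨t', ht0', ht1'⟩⟩ := b
  obtain ⟨h0, h1, h2⟩ := (sphericalCoord_eq_iff _ _).1 h
  dsimp only at h0 h1 h2
  have hpi := Real.pi_pos
  have ht : t = t' := mul_left_cancel₀ hpi.ne'
    (Real.injOn_cos ⟨by positivity, by nlinarith⟩ ⟨by positivity, by nlinarith⟩ h2)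
  subst ht
  simp only [Prod.mk.injEq, Subtype.ext_iff, Set.Icc.coe_zero, Set.Icc.coe_one,
    and_true, true_and]
  by_cases ht0' : t = 0
  · simp [ht0']
  by_cases ht1' : t = 1
  · simp [ht1']
  have hsin : Real.sin (Real.pi * t) ≠ 0 := by
    have h3 : 0 < t := lt_of_le_of_ne ht0 (Ne.symm ht0')
    have h4 : t < 1 := lt_of_le_of_ne ht1 ht1'
    exact (Real.sin_pos_of_pos_of_lt_pi (by positivity) (by nlinarith)).ne'
  have hc := mul_left_cancel₀ hsin h0
  have hsn := mul_left_cancel₀ hsin h1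
  have h5 : Real.cos (2 * Real.pi * s - 2 * Real.pi * s') = 1 := by
    rw [Real.cos_sub, hc, hsn, ← sq, ← sq, Real.cos_sq_add_sin_sq]
  obtain ⟨k, hk⟩ := (Real.cos_eq_one_iff _).1 h5
  have hk' : (k : ℝ) = s - s' := by
    have : (2 * Real.pi) * k = (2 * Real.pi) * (s - s') := by linarith
    exact mul_left_cancel₀ (by positivity) this
  have hk1 : k ≤ 1 := by
    have : (k : ℝ) ≤ 1 := by linarith
    exact_mod_cast this
  have hk2 : -1 ≤ k := by
    have : (-1 : ℝ) ≤ k := by linarith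
    exact_mod_cast this
  have hk3 : k = -1 ∨ k = 0 ∨ k = 1 := by omega
  rcases hk3 with rfl | rfl | rfl <;> norm_num at hk'
  · exact Or.inr (Or.inr (Or.inr (Or.inl ⟨by linarith, by linarith⟩)))
  · exact Or.inl (by linarith)
  · exact Or.inr (Or.inr (Or.inr (Or.inr ⟨by linarith, by linarith⟩)))

/-- On a sphere, a compatible system of local functions has a local maximum. -/
theorem LocallyCompatible.exists_localMax_of_sphere {X : Type*} [TopologicalSpace X]
    (e : X ≃ₜ Metric.sphere (0 : EuclideanSpace ℝ (Fin 3)) 1)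
    {g : X → X → ℝ} (hg : LocallyCompatible g) (hgc : ∀ x, ContinuousAt (g x) x) :
    ∃ x, ∀ᶠ y in 𝓝 x, g x y ≤ g x x := by
  have : T2Space X := e.isEmbedding.t2Space
  refine hg.exists_localMax_of_square hgc (q := fun a => e.symm (sphericalCoord a))
    (e.symm.continuous.comp continuous_sphericalCoord)
    (e.symm.surjective.comp surjective_sphericalCoord)
    (fun s => congrArg e.symm ((sphericalCoord_eq_iff _ _).2 (by simp)))
    (fun s => congrArg e.symm ((sphericalCoord_eq_iff _ _).2 (by simp)))
    (fun t => congrArg e.symm ((sphericalCoord_eq_iff _ _).2 (by simp)))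
    (fun a b hab => eq_or_of_sphericalCoord_eq a b (e.symm.injective hab))

end LocalPrimitives

/-! ### Calculus on manifolds and regularity of forms. -/

section ManifoldCalculus

open Filter Set

variable {E : Type*} [NormedAddCommGroup E] [NormedSpace ℝ E] {M : Type*} [TopologicalSpace M]
  [ChartedSpace E M]

theorem mfderiv_eq_zero_of_isLocalMax {f : M → ℝ} {x : M} (h : IsLocalMax f x) :
    mfderiv 𝓘(ℝ, E) 𝓘(ℝ, ℝ) f x = 0 := by
  by_cases hf : MDifferentiableAt 𝓘(ℝ, E) 𝓘(ℝ, ℝ) f x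
  · have hd := hf.hasMFDerivAt.2
    rw [ModelWithCorners.range_eq_univ] at hd
    replace hd := hd.hasFDerivAt Filter.univ_mem
    have hc := (continuousOn_extChartAt_symm (I := 𝓘(ℝ, E)) x).continuousAt
      (extChartAt_target_mem_nhds x)
    have hm : IsLocalMax (f ∘ (extChartAt 𝓘(ℝ, E) x).symm) (extChartAt 𝓘(ℝ, E) x x) := by
      refine IsMaxFilter.comp_tendsto (l := 𝓝 x) ?_ ?_
      · rw [extChartAt_to_inv]; exact h
      · simpa [ContinuousAt, extChartAt_to_inv] using hc
    exact hm.hasFDerivAt_eq_zero hd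
  · exact mfderiv_zero_of_not_mdifferentiableAt hf

variable [IsManifold 𝓘(ℝ, E) ∞ M]

/-- In a chart ball the difference has zero derivative. This makes the local primitives of a closed
form a compatible system. -/
theorem eventually_sub_eq_sub_of_hasMFDerivAt
    {θ : ∀ q : M, TangentSpace 𝓘(ℝ, E) q →L[ℝ] ℝ} {f g : M → ℝ} {y : M}
    (hf : ∀ᶠ q in 𝓝 y, HasMFDerivAt 𝓘(ℝ, E) 𝓘(ℝ, ℝ) f q (θ q))
    (hg : ∀ᶠ q in 𝓝 y, HasMFDerivAt 𝓘(ℝ, E) 𝓘(ℝ, ℝ) g q (θ q)) :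
    ∀ᶠ q in 𝓝 y, f q - f y = g q - g y := by
  set φ := extChartAt 𝓘(ℝ, E) y with hφ
  have hc : Tendsto φ.symm (𝓝 (φ y)) (𝓝 y) := by
    have := (continuousOn_extChartAt_symm (I := 𝓘(ℝ, E)) y).continuousAt
      (extChartAt_target_mem_nhds y)
    rwa [ContinuousAt, extChartAt_to_inv] at this
  obtain ⟨r, hr, hball⟩ := Metric.eventually_nhds_iff_ball.1
    ((hc.eventually (hf.and hg)).and (extChartAt_target_mem_nhds (I := 𝓘(ℝ, E)) y))
  have hd : ∀ z ∈ Metric.ball (φ y) r, ∀ h : M → ℝ,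
      HasMFDerivAt 𝓘(ℝ, E) 𝓘(ℝ, ℝ) h (φ.symm z) (θ (φ.symm z)) →
      HasFDerivAt (h ∘ φ.symm)
        ((θ (φ.symm z)).comp (mfderiv 𝓘(ℝ, E) 𝓘(ℝ, E) φ.symm z) : E →L[ℝ] ℝ) z := by
    intro z hz h hh
    have hs : MDifferentiableAt 𝓘(ℝ, E) 𝓘(ℝ, E) φ.symm z :=
      ((contMDiffOn_extChartAt_symm (n := ∞) y).contMDiffAt
        ((isOpen_extChartAt_target y).mem_nhds (hball z hz).2)).mdifferentiableAt (by simp)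
    exact hasMFDerivAt_iff_hasFDerivAt.1 (hh.comp z hs.hasMFDerivAt)
  have hconst : ∀ z ∈ Metric.ball (φ y) r,
      (f ∘ φ.symm - g ∘ φ.symm) z = (f ∘ φ.symm - g ∘ φ.symm) (φ y) := fun z hz => by
    have hdz : ∀ z ∈ Metric.ball (φ y) r, HasFDerivAt (f ∘ φ.symm - g ∘ φ.symm) (0 : E →L[ℝ] ℝ) z :=
      fun z hz => by
        have := (hd z hz f (hball z hz).1.1).sub (hd z hz g (hball z hz).1.2)
        rwa [sub_self] at this
    exact Metric.isOpen_ball.is_const_of_fderiv_eq_zero (𝕜 := ℝ)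
      (convex_ball (φ y) r).isPreconnected
      (fun z hz => (hdz z hz).differentiableAt.differentiableWithinAt)
      (fun z hz => (hdz z hz).fderiv) hz (Metric.mem_ball_self hr)
  have hφc : ContinuousAt φ y := continuousAt_extChartAt y
  filter_upwards [hφc.eventually (Metric.ball_mem_nhds _ hr),
    extChartAt_source_mem_nhds (I := 𝓘(ℝ, E)) y] with q hq hqs
  have := hconst (φ q) hq
  simp only [Pi.sub_apply, Function.comp_apply] at this
  rw [φ.left_inv hqs, φ.left_inv (mem_extChartAt_source y)] at this
  linarith

end ManifoldCalculus

theorem isManifold_real_of_complex (S : Type*) [TopologicalSpace S] [ChartedSpace ℂ S]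
    [IsManifold 𝓘(ℂ) ω S] : IsManifold 𝓘(ℝ, ℂ) ∞ S := by
  refine isManifold_of_contDiffOn _ _ _ fun e e' he he' => ?_
  have h := contDiffGroupoid ω 𝓘(ℂ) |>.compatible (M := S) he he'
  rw [contDiffGroupoid, mem_groupoid_of_pregroupoid] at h
  have h2 : ContDiffOn ℂ ω _ _ := h.1
  exact (h2.restrict_scalars ℝ).of_le le_top

theorem continuous_oneForm {m : ℕ} {M : Type*} [TopologicalSpace M]
    [ChartedSpace (EuclideanSpace ℝ (Fin m)) M] [IsManifold (𝓡 m) ∞ M] (θ : OneForm m M) :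
    Continuous fun v : TangentBundle (𝓡 m) M => θ v.1 v.2 := by
  have h1 := θ.contMDiff.comp (Bundle.contMDiff_proj (IB := 𝓡 m) (n := ∞)
    (F := EuclideanSpace ℝ (Fin m)) (TangentSpace (𝓡 m) : M → Type _))
  have h2 := ContMDiff.clm_bundle_apply (b := fun v : TangentBundle (𝓡 m) M => v.1)
    (v := fun v => v.2) (ϕ := fun v => θ v.1) (E₂ := Bundle.Trivial M ℝ) h1 contMDiff_id
  exact continuous_snd.comp ((Bundle.Trivial.homeomorphProd M ℝ).continuous.comp h2.continuous)

/-! ### Pairings of λ and α with the canonical vector fields. -/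

namespace ExactLcs

variable {n : ℕ} {M : Type*} [TopologicalSpace M]
  [ChartedSpace (EuclideanSpace ℝ (Fin (2 * n))) M] [IsManifold (𝓡 (2 * n)) ∞ M]

theorem omega_swap (L : ExactLcs n M) (p : M) (v w : TangentSpace (𝓡 (2 * n)) p) :
    L.omega p v w = -L.omega p w v := by
  simp only [omega, extDerivOneForm, wedge, LinearMap.sub_apply, LinearMap.mk₂_apply]
  ring

theorem lam_XLam (L : ExactLcs n M) (p : M) : L.lam p (L.XLam p) = 0 := by
  have h := L.omega_dual p (L.lam p) (L.XLam p)
  have h' := L.omega_swap p (L.XLam p) (L.XLam p)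
  change L.omega p (L.XLam p) (L.XLam p) = _ at h
  linarith

theorem alpha_XAlpha (L : ExactLcs n M) (p : M) : L.alpha p (L.XAlpha p) = 0 := by
  have h := L.omega_dual p (L.alpha p) (L.XAlpha p)
  have h' := L.omega_swap p (L.XAlpha p) (L.XAlpha p)
  change L.omega p (L.XAlpha p) (L.XAlpha p) = _ at h
  linarith

theorem alpha_XLam (L : ExactLcs n M) (p : M) :
    L.alpha p (L.XLam p) = -L.lam p (L.XAlpha p) := by
  have h := L.omega_dual p (L.lam p) (L.XAlpha p)
  have h' := L.omega_dual p (L.alpha p) (L.XLam p)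
  rw [← h, ← h', ← L.omega_swap]
  rfl

/-- Pairing (X_α, X_λ) with (λ, α) gives the diagonal matrix with entries λ(X_α) and -λ(X_α), which
is invertible. -/
theorem finrank_canonicalDistribution (L : ExactLcs n M) (hL : L.ReebCondition) (p : M) :
    Module.finrank ℝ (L.canonicalDistribution p) = 2 := by
  have hli : LinearIndependent ℝ ![L.XAlpha p, L.XLam p] := by
    rw [LinearIndependent.pair_iff]
    intro s t hst
    have hpos := hL p
    have h1 := congrArg (L.lam p) hst
    have h2 := congrArg (L.alpha p) hst
    rw [map_add, map_smul, map_smul, L.lam_XLam, map_zero] at h1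
    rw [map_add, map_smul, map_smul, L.alpha_XLam, L.alpha_XAlpha, map_zero] at h2
    have h1' : s * L.lam p (L.XAlpha p) + t * 0 = 0 := h1
    have h2' : s * 0 + t * -L.lam p (L.XAlpha p) = 0 := h2
    refine ⟨?_, ?_⟩
    · simpa [hpos.ne'] using h1'
    · simpa [hpos.ne'] using h2'
  have := finrank_span_eq_card hli
  rwa [Matrix.range_cons, Matrix.range_cons, Matrix.range_empty, Set.union_empty,
    Set.singleton_union, Fintype.card_fin] at this

end ExactLcs

/-! ### Consequences for immersed Reeb 2-curves. -/

section ReebCurves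

variable {n : ℕ} {M : Type*} [TopologicalSpace M]
  [ChartedSpace (EuclideanSpace ℝ (Fin (2 * n))) M] [IsManifold (𝓡 (2 * n)) ∞ M]
  {S : Type*} [TopologicalSpace S] [ChartedSpace ℂ S] {L : ExactLcs n M}
  {N : NodalStructure S} {u : N.Space → M}

theorem IsReebTwoCurve.range_mfderiv (hu : IsReebTwoCurve L N u) (hL : L.ReebCondition)
    (himm : IsImmersedCurve (2 * n) N u) (z : S) :
    (mfderiv 𝓘(ℝ, ℂ) (𝓡 (2 * n)) (u ∘ N.proj) z).range =
      L.canonicalDistribution ((u ∘ N.proj) z) := by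
  refine hu.tangent z (fun h => ?_) (L.finrank_canonicalDistribution hL _)
  have h1 : mfderiv 𝓘(ℝ, ℂ) (𝓡 (2 * n)) (u ∘ N.proj) z (1 : ℂ) =
      mfderiv 𝓘(ℝ, ℂ) (𝓡 (2 * n)) (u ∘ N.proj) z (0 : ℂ) := by rw [h]; rfl
  exact one_ne_zero (α := ℂ) (himm.2 z h1)

/-- Over an empty surface there are no paths, so the cocycle would be the coboundary of 0. -/
theorem IsReebTwoCurve.nonempty (hu : IsReebTwoCurve L N u) : Nonempty S := by
  by_contra h
  rw [not_nonempty_iff] at h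
  refine hu.class_ne_zero ⟨0, funext fun γ => ?_⟩
  obtain ⟨x, -⟩ := Quot.exists_rep (γ 0)
  exact h.elim x

theorem IsReebTwoCurve.exists_isReebOneCurve [CompactSpace S] [IsManifold 𝓘(ℂ) ω S]
    (hu : IsReebTwoCurve L N u) (hL : L.ReebCondition) (himm : IsImmersedCurve (2 * n) N u) :
    ∃ o : UnitAddCircle → M, L.IsReebOneCurve o := by
  have := hu.nonempty
  have := isManifold_real_of_complex S
  set v := u ∘ N.proj with hv
  have hvs : ContMDiff 𝓘(ℝ, ℂ) (𝓡 (2 * n)) ∞ v := hu.smooth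
  let β : ∀ z : S, TangentSpace 𝓘(ℝ, ℂ) z →L[ℝ] ℝ := fun z =>
    (L.lam (v z)).comp (mfderiv 𝓘(ℝ, ℂ) (𝓡 (2 * n)) v z)
  have hβ : Continuous fun w : TangentBundle 𝓘(ℝ, ℂ) S => β w.1 w.2 :=
    (continuous_oneForm L.lam).comp (hvs.continuous_tangentMap (by simp))
  have hβne : ∀ z, β z ≠ 0 := fun z hz => by
    have hmem : L.XAlpha (v z) ∈ L.canonicalDistribution (v z) :=
      Submodule.subset_span (by simp)
    rw [← hu.range_mfderiv hL himm z] at hmem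
    obtain ⟨w, hw⟩ := hmem
    have h1 : β z w = L.lam (v z) (L.XAlpha (v z)) := congrArg (L.lam (v z)) hw
    rw [hz] at h1
    exact (hL (v z)).ne h1
  obtain ⟨γ, hγper, hγ⟩ := exists_periodic_positive hβ hβne
  have hper : Function.Periodic (v ∘ γ) 1 := hγper.comp v
  refine ⟨hper.lift, ?_⟩
  have hlift : (fun t : ℝ => hper.lift (t : UnitAddCircle)) = v ∘ γ :=
    funext fun t => hper.lift_coe t
  have hd : ∀ t, mfderiv 𝓘(ℝ, ℝ) (𝓡 (2 * n)) (v ∘ γ) t (1 : ℝ) =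
      mfderiv 𝓘(ℝ, ℂ) (𝓡 (2 * n)) v (γ t) (mfderiv 𝓘(ℝ, ℝ) 𝓘(ℝ, ℂ) γ t (1 : ℝ)) := fun t => by
    rw [mfderiv_comp t (hvs.mdifferentiableAt (by simp)) ((hγ t).1.mdifferentiableAt (by simp))]
    rfl
  unfold ExactLcs.IsReebOneCurve
  rw [hlift]
  refine ⟨fun t => hvs.contMDiffAt.comp t (hγ t).1, fun t => ?_⟩
  rw [hper.lift_coe t, hd]
  refine ⟨(hγ t).2, ?_⟩
  change _ ∈ L.canonicalDistribution (v (γ t))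
  rw [← hu.range_mfderiv hL himm (γ t)]
  exact ⟨_, rfl⟩

/-- Local primitives of α, composed with ũ, would have a local maximum on the sphere. There ũ*α
vanishes, yet X_λ lies in the image of dũ and α(X_λ) ≠ 0. -/
theorem IsReebTwoCurve.not_homeomorph_sphere [IsManifold 𝓘(ℂ) ω S]
    (hu : IsReebTwoCurve L N u) (hL : L.ReebCondition) (himm : IsImmersedCurve (2 * n) N u)
    {C : Set S} (hC : IsOpen C) :
    IsEmpty (C ≃ₜ Metric.sphere (0 : EuclideanSpace ℝ (Fin 3)) 1) := by
  refine ⟨fun e => ?_⟩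
  have := isManifold_real_of_complex S
  set v := u ∘ N.proj with hv
  have hvs : ContMDiff 𝓘(ℝ, ℂ) (𝓡 (2 * n)) ∞ v := hu.smooth
  choose U g hUo hU hg using exists_local_primitive L.alpha L.closed
  have hev : ∀ p, ∀ q ∈ U p, ∀ᶠ r in 𝓝 q, HasMFDerivAt (𝓡 (2 * n)) 𝓘(ℝ, ℝ) (g p) r (L.alpha r) :=
    fun p q hq => Filter.eventually_of_mem ((hUo p).mem_nhds hq) (hg p)
  have hcomp : LocallyCompatible g := fun p => by
    filter_upwards [(hUo p).mem_nhds (hU p)] with q hq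
    exact eventually_sub_eq_sub_of_hasMFDerivAt (hev p q hq) (hev q q (hU q))
  have hcont : ∀ p, ContinuousAt (g p) p := fun p => (hg p p (hU p)).continuousAt
  have hvC : Continuous fun z : C => v z := hvs.continuous.comp continuous_subtype_val
  obtain ⟨⟨x, hx⟩, hmax⟩ := (hcomp.comp hvC).exists_localMax_of_sphere e
    fun z => ContinuousAt.comp (f := fun z : C => v z) (hcont (v z)) hvC.continuousAt
  -- Openness of `C` turns a maximum within `C` into a local maximum on `S`.
  have hloc : IsLocalMax (g (v x) ∘ v) x := by
    have := (hC.isOpenEmbedding_subtypeVal.map_nhds_eq ⟨x, hx⟩)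
    change ∀ᶠ y in 𝓝 x, g (v x) (v y) ≤ g (v x) (v x)
    rw [← show _ = 𝓝 x from this]
    exact hmax
  have hzero := mfderiv_eq_zero_of_isLocalMax (E := ℂ) hloc
  have hd := (hg (v x) (v x) (hU (v x))).comp x
    (hvs.mdifferentiableAt (x := x) (by simp)).hasMFDerivAt
  rw [hd.mfderiv] at hzero
  have hmem : L.XLam (v x) ∈ L.canonicalDistribution (v x) := Submodule.subset_span (by simp)
  rw [← hu.range_mfderiv hL himm x] at hmem
  obtain ⟨w, hw⟩ := hmem
  have h1 : L.alpha (v x) (mfderiv 𝓘(ℝ, ℂ) (𝓡 (2 * n)) v x w) = 0 := DFunLike.congr_fun hzero w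
  have h2 : L.alpha (v x) (L.XLam (v x)) = 0 := (congrArg (L.alpha (v x)) hw).symm.trans h1
  rw [L.alpha_XLam] at h2
  exact (hL (v x)).ne' (neg_eq_zero.1 h2)

theorem IsReebTwoCurve.isNormal_of_hasGenus_one [IsManifold 𝓘(ℂ) ω S]
    (hu : IsReebTwoCurve L N u) (hL : L.ReebCondition) (himm : IsImmersedCurve (2 * n) N u)
    (hN : N.HasGenus 1) : N.IsNormal := by
  obtain ⟨c, e, g, hg, hsum⟩ := hN
  have : LocallyConnectedSpace S := ChartedSpace.locallyConnectedSpace ℂ S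
  have hpos : ∀ i ∈ Finset.univ, 1 ≤ g i := fun i _ => by
    rcases hg i with ⟨-, ⟨f⟩⟩ | ⟨h, -⟩
    · have hC : IsOpen {x : S | ConnectedComponents.mk x = e i} := by
        obtain ⟨y, hy⟩ := ConnectedComponents.surjective_coe (e i)
        have : {x : S | ConnectedComponents.mk x = e i} = connectedComponent y := by
          rw [← connectedComponents_preimage_singleton, hy]; rfl
        rw [this]
        exact isOpen_connectedComponent
      exact ((hu.not_homeomorph_sphere hL himm hC).false f).elim
    · exact h
  have h : c ≤ ∑ i, g i := by simpa using Finset.card_nsmul_le_sum Finset.univ g 1 hpos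
  unfold NodalStructure.IsNormal
  omega

end ReebCurves

end Lcs

theorem theorem3p5 {n : ℕ} {M : Type*} [TopologicalSpace M] [T2Space M]
    [SecondCountableTopology M] [ChartedSpace (EuclideanSpace ℝ (Fin (2 * n))) M]
    [IsManifold (𝓡 (2 * n)) ∞ M] (L : Lcs.ExactLcs n M) (hL : L.ReebCondition)
    {S : Type*} [TopologicalSpace S] [T2Space S] [CompactSpace S] [ChartedSpace ℂ S]
    [IsManifold 𝓘(ℂ) ω S] (N : Lcs.NodalStructure S) (u : N.Space → M)
    (hu : Lcs.IsReebTwoCurve L N u) (himm : Lcs.IsImmersedCurve (2 * n) N u) :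
    (∃ o : UnitAddCircle → M, L.IsReebOneCurve o) ∧ (N.IsElliptic → N.IsNormal) :=
  ⟨hu.exists_isReebOneCurve hL himm, fun h => hu.isNormal_of_hasGenus_one hL himm h.2⟩
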